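/- Let $N\ge 1$ and let $L^2(\mathbb R^3)$ be the real Hilbert space of square-integrable functions, with inner product $\langle v,\rho\rangle=\int v\rho$. Let $L^2_N$ be the space of antisymmetric square-integrable functions $\psi$ on $(\mathbb R^3\times\mathbb Z_2)^N$, let $H^1_N\subset L^2_N$ be the subspace of those whose $2^N$ spatial components lie in $H^1(\mathbb R^{3N})$, and let $\mathcal W_N=\{\psi\in H^1_N:\|\psi\|_2=1\}$. Put $$\mathcal E_0[\psi]=\tfrac12\langle\nabla\psi,\nabla\psi\rangle+\Big\langle\psi,\sum_{i<j}\frac1{|\mathbf r_i-\mathbf r_j|}\,\psi\Big\rangle ,\qquad \rho_\psi(\mathbf r)=N\sum_{s\in\mathbb Z_2}\int|\psi((\mathbf r,s),\mathbf x_2,\dots,\mathbf x_N)|^2\,d\mathbf x_2\cdots d\mathbf x_N .$$ Let $\hat H[v]$ be the self-adjoint operator on $L^2_N$ associated with the quadratic form $\psi\mapsto\mathcal E_0[\psi]+\int\rho_\psi v$ with form domain $H^1_N$. For $\rho\in L^2(\mathbb R^3)$ let $$F_{\mathrm{DM}}[\rho]=\inf\Big\{\sum_k\lambda_k\,\mathcal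 E_0[\psi_k]\Big\}\in[0,+\infty],$$ where the infimum is over all finite or infinite sequences with $\lambda_k\ge 0$, $\sum_k\lambda_k=1$, $\psi_k\in\mathcal W_N$ orthonormal in $L^2_N$, and $\sum_k\lambda_k\rho_{\psi_k}=\rho$ almost everywhere ($\inf\emptyset=+\infty$). Define $$E[v]=\inf_{\rho\in L^2(\mathbb R^3)}\{F_{\mathrm{DM}}[\rho]+\langle v,\rho\rangle\},\qquad F[\rho]=E^\vee[\rho]=\sup_{v\in L^2(\mathbb R^3)}\{E[v]-\langle v,\rho\rangle\}.$$ Then: 1. $E[v]$ is a real number with $E[v]\le 0$ for every $v\in L^2(\mathbb R^3)$, and $E[v]=0$ whenever $v\ge 0$ almost everywhere. 2. $F[0]=0$ although $F_{\mathrm{DM}}[0]=+\infty$, and $F_{\mathrm{DM}}$ is not lower semicontinuous on $L^2(\mathbb R^3)$. 3. $0\in\underline\partial F[0]$, i.e. $F[\rho]\ge F[0]$ for all $\rho\in L^2(\mathbb R^3)$, and $0\in\overline\partial E[0]$, i.e. $E[v]\le E[0]$ for all $v\in L^2(\mathbb R^3)$; but $\hat H[0]$ has no ground-state wave function: no $\psi\in\mathcal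 W_N$ minimizes $\mathcal E_0$ over $\mathcal W_N$, and no $\psi\in\mathcal W_N$ is an eigenfunction of $\hat H[0]$ with eigenvalue $\inf_{\varphi\in\mathcal W_N}\mathcal E_0[\varphi]$, the bottom of its spectrum. -/

import Mathlib

open MeasureTheory
open scoped ENNReal ContDiff

noncomputable section

namespace DFT

/-! ### Skew conjugation and sub/superdifferentials on a real Hilbert space

The Hilbert space is identified with its dual through the inner product. -/

section ConvexAnalysis

variable {H : Type*} [NormedAddCommGroup H] [InnerProductSpace ℝ H]

/-- Skew concave conjugate: `f^∧[v] = inf_x (f[x] + ⟨v, x⟩)`. -/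
def concaveConj (f : H → EReal) (v : H) : EReal :=
  ⨅ x : H, f x + ((inner ℝ v x : ℝ) : EReal)

/-- Skew convex conjugate: `g^∨[x] = sup_v (g[v] - ⟨v, x⟩)`. -/
def convexConj (g : H → EReal) (x : H) : EReal :=
  ⨆ v : H, g v - ((inner ℝ v x : ℝ) : EReal)

/-- The subdifferential of `f` at `x`. -/
def subdifferential (f : H → EReal) (x : H) : Set H :=
  {y | ∀ x' : H, f x + ((inner ℝ y (x' - x) : ℝ) : EReal) ≤ f x'}

/-- The superdifferential of `g` at `x`. -/
def superdifferential (g : H → EReal) (x : H) : Set H :=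
  {y | ∀ x' : H, g x' ≤ g x + ((inner ℝ y (x' - x) : ℝ) : EReal)}

end ConvexAnalysis

/-! ### Wave functions -/

/-- Physical space `ℝ³`. -/
abbrev Point : Type := EuclideanSpace ℝ (Fin 3)

/-- Spatial configurations of `N` particles, i.e. points of `ℝ^{3N}`. -/
abbrev Config (N : ℕ) : Type := Fin N → Point

/-- A function on `(ℝ³ × {↑, ↓})^N`, given by its `2^N` spatial components. -/
abbrev WaveFunction (N : ℕ) : Type := (Fin N → Fin 2) → Config N → ℂ

/-- The unit vector of `ℝ^{3N}` in the `a`-th spatial direction of particle `i`. -/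
def unitVec {N : ℕ} (i : Fin N) (a : Fin 3) : Config N :=
  Pi.single i (EuclideanSpace.single a 1)

/-- `g` is a weak partial derivative of `f` in the `a`-th direction of particle `i`: it satisfies
`∫ f ∂φ = - ∫ g φ` for all test functions `φ ∈ C_c^∞(ℝ^{3N})`. -/
def HasWeakPartial {N : ℕ} (i : Fin N) (a : Fin 3) (f g : Config N → ℂ) : Prop :=
  ∀ φ : Config N → ℝ, ContDiff ℝ ∞ φ → HasCompactSupport φ →
    ∫ r, ((fderiv ℝ φ r (unitVec i a) : ℝ) : ℂ) * f r = - ∫ r, ((φ r : ℝ) : ℂ) * g r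

/-- `f` belongs to the Sobolev space `H¹(ℝ^{3N})`. -/
def IsH1 {N : ℕ} (f : Config N → ℂ) : Prop :=
  MemLp f 2 volume ∧
    ∀ (i : Fin N) (a : Fin 3), ∃ g : Config N → ℂ, MemLp g 2 volume ∧ HasWeakPartial i a f g

open Classical in
/-- The square-integrable weak partial derivative (unique up to null sets); zero if there is
none. -/
def weakPartial {N : ℕ} (i : Fin N) (a : Fin 3) (f : Config N → ℂ) : Config N → ℂ :=
  if h : ∃ g : Config N → ℂ, MemLp g 2 volume ∧ HasWeakPartial i a f g then h.choose else 0

/-- Antisymmetry under simultaneous permutation of positions and spins. -/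
def IsAntisymmetric {N : ℕ} (ψ : WaveFunction N) : Prop :=
  ∀ (σ : Equiv.Perm (Fin N)) (s : Fin N → Fin 2),
    ∀ᵐ r : Config N, ψ (s ∘ σ) (r ∘ σ) = ((Equiv.Perm.sign σ : ℤ) : ℂ) * ψ s r

/-- The fermionic space `L²_N`. -/
def L2N (N : ℕ) : Set (WaveFunction N) :=
  {ψ | (∀ s, MemLp (ψ s) 2 volume) ∧ IsAntisymmetric ψ}

/-- The space `H¹_N` of fermionic wave functions of finite kinetic energy. -/
def H1N (N : ℕ) : Set (WaveFunction N) :=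
  {ψ | (∀ s, IsH1 (ψ s)) ∧ IsAntisymmetric ψ}

/-- The inner product of `L²_N`, conjugate-linear in the first argument. -/
def braket {N : ℕ} (φ ψ : WaveFunction N) : ℂ :=
  ∑ s, ∫ r, (starRingEnd ℂ) (φ s r) * ψ s r

/-- The normalized fermionic wave functions of finite kinetic energy. -/
def WN (N : ℕ) : Set (WaveFunction N) :=
  {ψ | ψ ∈ H1N N ∧ ∑ s, ∫⁻ r, ‖ψ s r‖ₑ ^ 2 = 1}

/-! ### Energies and densities -/

/-- The electron-electron repulsion `W(r₁, …, r_N) = ∑_{i<j} 1 / |r_i - r_j|`. -/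
def coulomb {N : ℕ} (r : Config N) : ℝ :=
  ∑ i : Fin N, ∑ j : Fin N, if i < j then (dist (r i) (r j))⁻¹ else 0

/-- `𝓔₀[ψ] = ½ ⟨∇ψ, ∇ψ⟩ + ⟨ψ, W ψ⟩`, with values in `[0, ∞]`. -/
def internalEnergy {N : ℕ} (ψ : WaveFunction N) : ℝ≥0∞ :=
  2⁻¹ * (∑ s, ∑ i, ∑ a, ∫⁻ r, ‖weakPartial i a (ψ s) r‖ₑ ^ 2)
    + ∑ s, ∫⁻ r, ENNReal.ofReal (coulomb r) * ‖ψ s r‖ₑ ^ 2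

/-- The one-electron density `ρ_ψ(r) = N ∑_s ∫ |ψ(r, s; x₂, …, x_N)|² dx₂ ⋯ dx_N`. -/
def density : {N : ℕ} → WaveFunction N → Point → ℝ≥0∞
  | 0, _, _ => 0
  | n + 1, ψ, r =>
    ((n + 1 : ℕ) : ℝ≥0∞) *
      ∑ s : Fin (n + 1) → Fin 2, ∫⁻ y : Config n, ‖ψ s (Fin.cons r y : Config (n + 1))‖ₑ ^ 2

/-- `L²(ℝ³)`, the real Hilbert space of densities and of potentials. -/
abbrev L2 : Type := Lp ℝ 2 (volume : Measure Point)

/-- `𝓔₀[ψ] + ∫ ρ_ψ v`, the energy of `ψ` in the external potential `v`. -/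
def energy {N : ℕ} (v : L2) (ψ : WaveFunction N) : EReal :=
  (internalEnergy ψ : EReal) + ((∫ r : Point, (density ψ r).toReal * v r : ℝ) : EReal)

/-! ### Density operators and the density-matrix functional -/

/-- A density operator `γ = ∑_k λ_k |ψ_k⟩⟨ψ_k|` with `λ_k ≥ 0`, `∑_k λ_k = 1` and `ψ_k` orthonormal
elements of `𝓦_N`. Nothing is asked of `ψ_k` when `λ_k = 0`, so the sum may be finite. -/
structure DensityOperator (N : ℕ) where
  weight : ℕ → ℝ≥0∞
  state : ℕ → WaveFunction N
  tsum_weight : ∑' k, weight k = 1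
  state_mem : ∀ k, weight k ≠ 0 → state k ∈ WN N
  orthogonal : ∀ j k, j ≠ k → weight j ≠ 0 → weight k ≠ 0 → braket (state j) (state k) = 0

/-- `γ ↦ ρ`: the density `∑_k λ_k ρ_{ψ_k}` of `γ` equals `ρ` almost everywhere. -/
def DensityOperator.HasDensity {N : ℕ} (γ : DensityOperator N) (ρ : L2) : Prop :=
  ∀ᵐ r : Point, ((∑' k, γ.weight k * density (γ.state k) r : ℝ≥0∞) : EReal) = ((ρ r : ℝ) : EReal)

/-- `Tr(Ĥ[0] γ) = ∑_k λ_k 𝓔₀[ψ_k]`. -/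
def DensityOperator.traceH0 {N : ℕ} (γ : DensityOperator N) : ℝ≥0∞ :=
  ∑' k, γ.weight k * internalEnergy (γ.state k)

/-- The density-matrix constrained-search functional on `L²(ℝ³)`; it is `+∞` at every `ρ` that is
not the density of a density operator. -/
def FDM (N : ℕ) (ρ : L2) : EReal :=
  ((⨅ (γ : DensityOperator N) (_ : γ.HasDensity ρ), γ.traceH0 : ℝ≥0∞) : EReal)

/-- The ground-state energy `E[v] = inf_ρ (F_DM[ρ] + ⟨v, ρ⟩)`. -/
def E (N : ℕ) : L2 → EReal := concaveConj (FDM N)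

/-- The functional `F = E^∨`. -/
def F (N : ℕ) : L2 → EReal := convexConj (E N)

/-! ### The Hamiltonian and its ground states -/

/-- `ψ` is a minimizer of the variational ground-state problem with potential `v`. -/
def IsVariationalGroundState {N : ℕ} (v : L2) (ψ : WaveFunction N) : Prop :=
  ψ ∈ WN N ∧ ∀ φ ∈ WN N, energy v ψ ≤ energy v φ

/-- The sesquilinear form of the Hamiltonian with potential `v`. -/
def hamiltonianForm {N : ℕ} (v : L2) (φ ψ : WaveFunction N) : ℂ :=
  2⁻¹ * (∑ s, ∑ i, ∑ a,
      ∫ r, (starRingEnd ℂ) (weakPartial i a (φ s) r) * weakPartial i a (ψ s) r)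
    + ∑ s, ∫ r : Config N,
        ((coulomb r + ∑ i, v (r i) : ℝ) : ℂ) * ((starRingEnd ℂ) (φ s r) * ψ s r)

/-- `ψ` lies in the domain of the self-adjoint operator `Ĥ[v]` associated with the form, and
`Ĥ[v] ψ = η`. -/
def HamiltonianMapsTo {N : ℕ} (v : L2) (ψ η : WaveFunction N) : Prop :=
  ψ ∈ H1N N ∧ η ∈ L2N N ∧ ∀ φ ∈ H1N N, hamiltonianForm v φ ψ = braket φ η

/-- `ψ` is a ground-state wave function of `Ĥ[v]`: a normalized eigenfunction whose eigenvalue is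
the infimum of the energy, that is, the bottom of the spectrum. -/
def IsGroundState {N : ℕ} (v : L2) (ψ : WaveFunction N) : Prop :=
  ψ ∈ WN N ∧ ∃ lam : ℝ, HamiltonianMapsTo v ψ (fun s r => (lam : ℂ) * ψ s r) ∧
    ((lam : ℝ) : EReal) = ⨅ φ ∈ WN N, energy v φ

end DFT

end

/-! Everything rests on two facts about `𝓔₀`: it can be scaled down to zero, and it controls every
square-integrable potential.

Scaling. Fix a smooth, compactly supported, antisymmetric trial function with finite Coulomb energy
and dilate it by `lam`. The kinetic term picks up `lam ^ 2` and the repulsion `lam`, while the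
density becomes `lam ^ 3` times a dilate of a bounded density, so its squared `L²` norm is at most
`lam ^ 3 * B * N`. As `lam → 0`, energies tend to `0` and densities tend to `0` strongly
(`exists_tendsto_zero`). Hence `E[v] ≤ 0` for every `v`, the infimum of `𝓔₀` is `0`, and `FDM` tends
to `0` along densities converging to `0`. But every admissible density has mass `N > 0`, so `FDM 0 =
⊤`, and lower semicontinuity fails. The conjugate does not see this: `F 0` is the supremum of a
nonpositive function that vanishes at `v = 0`.

Control. Hölder and the three-dimensional Sobolev inequality in the first particle's variable give
`∫ w(r₀)|f|² ≤ C ‖w‖_{3/2} ‖∇₀f‖²` (`lintegral_mul_sq_le_weakPartial`). Splitting `|v| ≤ M + w` with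
`‖w‖_{3/2}` small makes the potential form bounded with respect to `𝓔₀`
(`exists_lintegral_density_mul_le`), whence `E[v] > -∞`. The same inequality with `w` the indicator
of a ball shows that vanishing kinetic energy forces `ψ = 0` (`kinetic_ne_zero`), so the infimum `0`
is not attained and `0` is not an eigenvalue. -/

namespace DFT

/-! ### Weak partial derivatives on configuration space. -/

section WeakDerivatives

open ContinuousLinearMap
open scoped Convolution

variable {N : ℕ}

instance : (volume : Measure (Config N)).IsNegInvariant :=
  Measure.pi.isNegInvariant _

theorem hasWeakPartial_fderiv {f : Config N → ℂ} (hf : ContDiff ℝ 1 f) (i : Fin N) (a : Fin 3) :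
    HasWeakPartial i a f (fun r => fderiv ℝ f r (unitVec i a)) := by
  intro φ hφ hc
  have hφd : ContDiff ℝ 1 φ := hφ.of_le (by norm_num)
  have hf' : Continuous fun r => fderiv ℝ f r (unitVec i a) :=
    (hf.continuous_fderiv one_ne_zero).clm_apply continuous_const
  have hφ' : Continuous fun r => fderiv ℝ φ r (unitVec i a) :=
    (hφd.continuous_fderiv one_ne_zero).clm_apply continuous_const
  have key := integral_smul_fderiv_eq_neg_fderiv_smul_of_integrable (μ := volume) (f := φ) (g := f)
    (v := unitVec i a)
    ((hφ'.smul hf.continuous).integrable_of_hasCompactSupport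
      ((hc.fderiv_apply ℝ (unitVec i a)).smul_right))
    ((hφd.continuous.smul hf').integrable_of_hasCompactSupport hc.smul_right)
    ((hφd.continuous.smul hf.continuous).integrable_of_hasCompactSupport hc.smul_right)
    (fun x _ => (hφd.differentiable one_ne_zero) x)
    (fun x _ => (hf.differentiable one_ne_zero) x)
  simp only [Complex.real_smul] at key
  rw [key, neg_neg]

theorem locallyIntegrable_of_memLp_two {f : Config N → ℂ} (hf : MemLp f 2 volume) :
    LocallyIntegrable f volume :=
  hf.locallyIntegrable (by norm_num)

/-- Fundamental lemma of the calculus of variations. It makes the choice inside `weakPartial`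
harmless. -/
theorem HasWeakPartial.ae_eq {i : Fin N} {a : Fin 3} {f g g' : Config N → ℂ}
    (h : HasWeakPartial i a f g) (h' : HasWeakPartial i a f g')
    (hg : LocallyIntegrable g volume) (hg' : LocallyIntegrable g' volume) : g =ᵐ[volume] g' := by
  refine ae_eq_of_integral_contDiff_smul_eq hg hg' fun φ hφ hc => ?_
  simpa only [Complex.real_smul, neg_inj] using (h φ hφ hc).symm.trans (h' φ hφ hc)

theorem memLp_weakPartial (i : Fin N) (a : Fin 3) (f : Config N → ℂ) :
    MemLp (weakPartial i a f) 2 volume := by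
  unfold weakPartial
  split_ifs with h
  · exact h.choose_spec.1
  · exact MemLp.zero

theorem IsH1.hasWeakPartial {f : Config N → ℂ} (hf : IsH1 f) (i : Fin N) (a : Fin 3) :
    HasWeakPartial i a f (weakPartial i a f) := by
  unfold weakPartial
  rw [dif_pos (hf.2 i a)]
  exact (hf.2 i a).choose_spec.2

theorem weakPartial_ae_eq {i : Fin N} {a : Fin 3} {f g : Config N → ℂ} (hg : MemLp g 2 volume)
    (h : HasWeakPartial i a f g) : weakPartial i a f =ᵐ[volume] g := by
  have hex : ∃ g : Config N → ℂ, MemLp g 2 volume ∧ HasWeakPartial i a f g := ⟨g, hg, h⟩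
  refine HasWeakPartial.ae_eq (i := i) (a := a) (f := f) ?_ h
    (locallyIntegrable_of_memLp_two (memLp_weakPartial i a f)) (locallyIntegrable_of_memLp_two hg)
  unfold weakPartial
  rw [dif_pos hex]
  exact hex.choose_spec.2

/-- The derivative falls on `η`, and `t ↦ η (x - t)` is itself a test function. The sign from the
reflection cancels the sign in the definition of a weak derivative. -/
theorem fderiv_convolution_eq {i : Fin N} {a : Fin 3} {f g : Config N → ℂ} {η : Config N → ℝ}
    (hη : ContDiff ℝ ∞ η) (hc : HasCompactSupport η) (hf : LocallyIntegrable f volume)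
    (h : HasWeakPartial i a f g) (x : Config N) :
    fderiv ℝ (η ⋆[lsmul ℝ ℝ, volume] f) x (unitVec i a) =
      (η ⋆[lsmul ℝ ℝ, volume] g) x := by
  have hη1 : ContDiff ℝ 1 η := hη.of_le (by norm_num)
  have hF := hc.hasFDerivAt_convolution_left (lsmul ℝ ℝ : ℝ →L[ℝ] ℂ →L[ℝ] ℂ) hη1 hf x
  rw [hF.fderiv, convolution_eq_swap,
    convolution_lsmul_swap]
  have hex := (hc.fderiv ℝ).convolutionExists_left ((lsmul ℝ ℝ : ℝ →L[ℝ] ℂ →L[ℝ] ℂ).precompL (Config N))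
    (hη1.continuous_fderiv one_ne_zero) hf x
  rw [ContinuousLinearMap.integral_apply hex.integrable_swap]
  have key := h (fun t => η (x - t)) (hη.comp (contDiff_const.sub contDiff_id))
    (hc.comp_homeomorph (Homeomorph.subLeft x))
  have hd : ∀ t, fderiv ℝ (fun t => η (x - t)) t (unitVec i a)
      = - fderiv ℝ η (x - t) (unitVec i a) := by
    intro t
    have h1 : HasFDerivAt (fun t => η (x - t))
        ((fderiv ℝ η (x - t)).comp (-(ContinuousLinearMap.id ℝ (Config N)))) t :=
      ((hη1.differentiable one_ne_zero) (x - t)).hasFDerivAt.comp t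
        ((hasFDerivAt_id t).const_sub x)
    rw [h1.fderiv]
    simp
  simp only [hd, Complex.ofReal_neg, neg_mul, integral_neg, neg_inj] at key
  simpa only [Complex.real_smul, precompL_apply, lsmul_apply] using! key

end WeakDerivatives

/-! ### Mollification contracts the `L²` norm. -/

section Mollification

open ContinuousLinearMap
open scoped Convolution

variable {G : Type*} [NormedAddCommGroup G] [NormedSpace ℝ G] [FiniteDimensional ℝ G]
  [MeasureSpace G] [BorelSpace G] [(volume : Measure G).IsAddHaarMeasure]

/-- Convolution with a probability density does not increase the `L²` norm. -/
theorem lintegral_sq_convolution_le {η : G → ℝ} (hη : Continuous η) (h0 : ∀ x, 0 ≤ η x)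
    (h1 : ∫⁻ x, ENNReal.ofReal (η x) = 1) {f : G → ℂ} (hf : AEStronglyMeasurable f volume) :
    ∫⁻ x, ‖(η ⋆[lsmul ℝ ℝ, volume] f) x‖ₑ ^ 2 ≤ ∫⁻ x, ‖f x‖ₑ ^ 2 := by
  wlog hfm : StronglyMeasurable f generalizing f
  · have := this hf.stronglyMeasurable_mk.aestronglyMeasurable hf.stronglyMeasurable_mk
    rw [convolution_congr (lsmul ℝ ℝ) (Filter.EventuallyEq.refl _ η) hf.ae_eq_mk]
    refine this.trans (le_of_eq (lintegral_congr_ae ?_))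
    filter_upwards [hf.ae_eq_mk] with x hx
    rw [hx]
  have hηm : Measurable fun t => ENNReal.ofReal (η t) := hη.measurable.ennreal_ofReal
  have hpt : ∀ x, ‖(η ⋆[lsmul ℝ ℝ, volume] f) x‖ₑ ^ 2
      ≤ ∫⁻ t, ENNReal.ofReal (η t) * ‖f (x - t)‖ₑ ^ 2 := by
    intro x
    have hA : ‖(η ⋆[lsmul ℝ ℝ, volume] f) x‖ₑ ≤ ∫⁻ t, ENNReal.ofReal (η t) * ‖f (x - t)‖ₑ := by
      rw [convolution_lsmul]
      refine (enorm_integral_le_lintegral_enorm _).trans (le_of_eq (lintegral_congr fun t => ?_))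
      rw [enorm_smul, Real.enorm_of_nonneg (h0 t)]
    have hfx : Measurable fun t => ‖f (x - t)‖ₑ :=
      (hfm.measurable.comp (measurable_const.sub measurable_id)).enorm
    -- Cauchy–Schwarz with `η` split as `η ^ (1/2) * η ^ (1/2)`; one factor integrates to `1`.
    have hB : ∫⁻ t, ENNReal.ofReal (η t) * ‖f (x - t)‖ₑ
        ≤ (∫⁻ t, ENNReal.ofReal (η t) * ‖f (x - t)‖ₑ ^ 2) ^ (1 / 2 : ℝ) := by
      have := ENNReal.lintegral_mul_le_Lp_mul_Lq volume Real.HolderConjugate.two_two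
        (f := fun t => ENNReal.ofReal (η t) ^ (1 / 2 : ℝ))
        (g := fun t => ENNReal.ofReal (η t) ^ (1 / 2 : ℝ) * ‖f (x - t)‖ₑ)
        (hηm.pow_const _).aemeasurable ((hηm.pow_const _).mul hfx).aemeasurable
      have e1 : ∀ y : ℝ≥0∞, y ^ (1 / 2 : ℝ) * y ^ (1 / 2 : ℝ) = y := fun y => by
        rw [← ENNReal.rpow_add_of_nonneg _ _ (by norm_num) (by norm_num)]; norm_num
      have e2 : ∀ y : ℝ≥0∞, (y ^ (1 / 2 : ℝ)) ^ (2 : ℝ) = y := fun y => by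
        rw [← ENNReal.rpow_mul]; norm_num
      simp only [Pi.mul_apply, ← mul_assoc, e1, e2, h1,
        ENNReal.mul_rpow_of_nonneg _ _ (show (0 : ℝ) ≤ 2 by norm_num), ENNReal.one_rpow, one_mul,
        ENNReal.rpow_two] at this
      exact this
    calc _ ≤ ((∫⁻ t, ENNReal.ofReal (η t) * ‖f (x - t)‖ₑ ^ 2) ^ (1 / 2 : ℝ)) ^ 2 := by
          gcongr; exact hA.trans hB
      _ = _ := by rw [← ENNReal.rpow_natCast, ← ENNReal.rpow_mul]; norm_num
  refine (lintegral_mono hpt).trans ?_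
  have hm : Measurable fun p : G × G => ENNReal.ofReal (η p.2) * ‖f (p.1 - p.2)‖ₑ ^ 2 :=
    (hηm.comp measurable_snd).mul
      ((hfm.measurable.comp (measurable_fst.sub measurable_snd)).enorm.pow_const 2)
  rw [lintegral_lintegral_swap hm.aemeasurable]
  have hin : ∀ t, ∫⁻ x, ENNReal.ofReal (η t) * ‖f (x - t)‖ₑ ^ 2
      = ENNReal.ofReal (η t) * ∫⁻ x, ‖f x‖ₑ ^ 2 := by
    intro t
    have hft : Measurable fun x => ‖f (x - t)‖ₑ ^ 2 :=
      (hfm.measurable.comp (measurable_id.sub measurable_const)).enorm.pow_const 2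
    rw [lintegral_const_mul _ hft,
      lintegral_sub_right_eq_self (fun x => ‖f x‖ₑ ^ 2) t]
  simp only [hin]
  rw [lintegral_mul_const _ hηm, h1, one_mul]

theorem lintegral_ofReal_normed_eq_one (φ : ContDiffBump (0 : G)) :
    ∫⁻ x, ENNReal.ofReal (φ.normed volume x) = 1 := by
  rw [← ofReal_integral_eq_lintegral_ofReal φ.integrable_normed
    (Filter.Eventually.of_forall φ.nonneg_normed), φ.integral_normed, ENNReal.ofReal_one]

end Mollification

/-! ### Fubini for the first particle against the rest. -/

section Slicing

theorem volume_preserving_consEquiv (n : ℕ) :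
    MeasurePreserving (fun p : Point × Config n => (Fin.cons p.1 p.2 : Config (n + 1)))
      volume volume := by
  have h := (volume_preserving_piFinSuccAbove (fun _ : Fin (n + 1) => Point) 0).symm
  have e : ⇑(MeasurableEquiv.piFinSuccAbove (fun _ : Fin (n + 1) => Point) 0).symm =
      fun p : Point × Config n => (Fin.cons p.1 p.2 : Config (n + 1)) := by
    funext p
    simp [MeasurableEquiv.piFinSuccAbove, Fin.insertNthEquiv]
  rwa [e] at h

theorem measurableEmbedding_cons (n : ℕ) :
    MeasurableEmbedding (fun p : Point × Config n => (Fin.cons p.1 p.2 : Config (n + 1))) := by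
  have h := (MeasurableEquiv.piFinSuccAbove
    (fun _ : Fin (n + 1) => Point) 0).symm.measurableEmbedding
  have e : ⇑(MeasurableEquiv.piFinSuccAbove (fun _ : Fin (n + 1) => Point) 0).symm =
      fun p : Point × Config n => (Fin.cons p.1 p.2 : Config (n + 1)) := by
    funext p
    simp [MeasurableEquiv.piFinSuccAbove, Fin.insertNthEquiv]
  rwa [e] at h

theorem aemeasurable_cons {n : ℕ} {g : Config (n + 1) → ℝ≥0∞} (hg : AEMeasurable g volume) :
    AEMeasurable (fun p : Point × Config n => g (Fin.cons p.1 p.2 : Config (n + 1)))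
      ((volume : Measure Point).prod (volume : Measure (Config n))) :=
  AEMeasurable.comp_quasiMeasurePreserving hg (volume_preserving_consEquiv n).quasiMeasurePreserving

theorem lintegral_config_succ {n : ℕ} {g : Config (n + 1) → ℝ≥0∞} (hg : AEMeasurable g volume) :
    ∫⁻ r, g r = ∫⁻ x : Point, ∫⁻ y : Config n, g (Fin.cons x y : Config (n + 1)) := by
  rw [← (volume_preserving_consEquiv n).lintegral_comp_emb (measurableEmbedding_cons n) g]
  exact lintegral_prod _ (aemeasurable_cons hg)

theorem lintegral_config_succ' {n : ℕ} {g : Config (n + 1) → ℝ≥0∞} (hg : AEMeasurable g volume) :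
    ∫⁻ r, g r = ∫⁻ y : Config n, ∫⁻ x : Point, g (Fin.cons x y : Config (n + 1)) := by
  rw [← (volume_preserving_consEquiv n).lintegral_comp_emb (measurableEmbedding_cons n) g]
  exact lintegral_prod_symm _ (aemeasurable_cons hg)

end Slicing

/-! ### Weighted Sobolev inequality for smooth functions. -/

section Sobolev

/-- The constant of the weighted Sobolev inequality on `ℝ³`. -/
noncomputable def sobolevConst : ℝ≥0∞ :=
  3 * (SNormLESNormFDerivOfEqConst ℂ (volume : Measure Point) 2 : ℝ≥0∞) ^ 2

theorem sobolevConst_ne_top : sobolevConst ≠ ⊤ :=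
  ENNReal.mul_ne_top (by norm_num) (ENNReal.pow_ne_top ENNReal.coe_ne_top)

/-- Expand in the standard basis and use Cauchy–Schwarz. That already gives constant `1`; the factor
`3` is slack, absorbed in `sobolevConst`. -/
theorem enorm_clm_sq_le (L : Point →L[ℝ] ℂ) :
    ‖L‖ₑ ^ 2 ≤ 3 * ∑ a : Fin 3, ‖L (EuclideanSpace.single a 1)‖ₑ ^ 2 := by
  have hreal : ‖L‖ ≤ Real.sqrt (3 * ∑ a : Fin 3, ‖L (EuclideanSpace.single a 1)‖ ^ 2) := by
    refine L.opNorm_le_bound (Real.sqrt_nonneg _) fun x => ?_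
    have hx : L x = ∑ a : Fin 3, x a • L (EuclideanSpace.single a 1) := by
      conv_lhs => rw [← (EuclideanSpace.basisFun (Fin 3) ℝ).sum_repr x]
      simp [map_sum]
    rw [hx, EuclideanSpace.norm_eq, ← Real.sqrt_mul (by positivity)]
    refine Real.le_sqrt_of_sq_le ?_
    have h1 : ‖∑ a : Fin 3, x a • L (EuclideanSpace.single a 1)‖
        ≤ ∑ a : Fin 3, ‖x a‖ * ‖L (EuclideanSpace.single a 1)‖ :=
      (norm_sum_le _ _).trans (Finset.sum_le_sum fun a _ => (norm_smul_le _ _))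
    have h2 := Finset.sum_mul_sq_le_sq_mul_sq Finset.univ (fun a : Fin 3 => ‖x a‖)
      (fun a => ‖L (EuclideanSpace.single a 1)‖)
    calc _ ≤ (∑ a : Fin 3, ‖x a‖ * ‖L (EuclideanSpace.single a 1)‖) ^ 2 := by gcongr
      _ ≤ _ := h2
      _ ≤ _ := by
        rw [mul_comm]
        gcongr
        have : 0 ≤ ∑ a : Fin 3, ‖L (EuclideanSpace.single a 1)‖ ^ 2 := by positivity
        linarith
  have h0 : 0 ≤ 3 * ∑ a : Fin 3, ‖L (EuclideanSpace.single a 1)‖ ^ 2 := by positivity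
  have hsq : ‖L‖ ^ 2 ≤ 3 * ∑ a : Fin 3, ‖L (EuclideanSpace.single a 1)‖ ^ 2 :=
    (pow_le_pow_left₀ (norm_nonneg _) hreal 2).trans_eq (Real.sq_sqrt h0)
  have := ENNReal.ofReal_le_ofReal hsq
  rw [ENNReal.ofReal_mul (by norm_num), ENNReal.ofReal_sum_of_nonneg (fun _ _ => by positivity),
    ENNReal.ofReal_pow (norm_nonneg _), ofReal_norm] at this
  simp only [ENNReal.ofReal_pow (norm_nonneg _), ofReal_norm] at this
  simpa using this

/-- Hölder with exponents `3/2` and `3` leaves `‖u‖₆²`, which Gagliardo–Nirenberg–Sobolev in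
dimension three bounds by the gradient in `L²`. -/
theorem lintegral_mul_sq_le_fderiv {u : Point → ℂ} (hu : ContDiff ℝ 1 u)
    (hc : HasCompactSupport u) {w : Point → ℝ≥0∞} (hw : Measurable w) :
    ∫⁻ x, w x * ‖u x‖ₑ ^ 2 ≤ sobolevConst * (∫⁻ x, w x ^ (3 / 2 : ℝ)) ^ (2 / 3 : ℝ) *
      ∑ a : Fin 3, ∫⁻ x, ‖fderiv ℝ u x (EuclideanSpace.single a 1)‖ₑ ^ 2 := by
  set C : ℝ≥0∞ := (SNormLESNormFDerivOfEqConst ℂ (volume : Measure Point) 2 : ℝ≥0∞)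
  have hS : eLpNorm u 6 volume ≤ C * eLpNorm (fderiv ℝ u) 2 volume := by
    have := eLpNorm_le_eLpNorm_fderiv_of_eq (μ := (volume : Measure Point)) (p := 2) (p' := 6)
      hu hc (by norm_num) (by simp) (by simp; norm_num)
    simpa using this
  have hH := ENNReal.lintegral_mul_le_Lp_mul_Lq (volume : Measure Point)
    (p := 3 / 2) (q := 3) (Real.holderConjugate_iff.2 ⟨by norm_num, by norm_num⟩)
    hw.aemeasurable (g := fun x => ‖u x‖ₑ ^ 2) (hu.continuous.measurable.enorm.pow_const 2).aemeasurable
  have e6 : (∫⁻ x, (‖u x‖ₑ ^ 2) ^ (3 : ℝ)) ^ (1 / 3 : ℝ) = eLpNorm u 6 volume ^ 2 := by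
    rw [eLpNorm_eq_lintegral_rpow_enorm_toReal (by norm_num) (by norm_num), ← ENNReal.rpow_natCast,
      ← ENNReal.rpow_mul]
    simp only [← ENNReal.rpow_natCast, ← ENNReal.rpow_mul]
    norm_num
  have e2 : eLpNorm (fderiv ℝ u) 2 volume ^ 2 = ∫⁻ x, ‖fderiv ℝ u x‖ₑ ^ 2 := by
    rw [eLpNorm_eq_lintegral_rpow_enorm_toReal (by norm_num) (by norm_num), ← ENNReal.rpow_natCast,
      ← ENNReal.rpow_mul]
    norm_num
  have hm : ∀ a : Fin 3, Measurable fun x => ‖fderiv ℝ u x (EuclideanSpace.single a 1)‖ₑ ^ 2 :=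
    fun a => (((hu.continuous_fderiv one_ne_zero).clm_apply
      continuous_const).measurable.enorm.pow_const 2)
  have hg : ∫⁻ x, ‖fderiv ℝ u x‖ₑ ^ 2
      ≤ 3 * ∑ a : Fin 3, ∫⁻ x, ‖fderiv ℝ u x (EuclideanSpace.single a 1)‖ₑ ^ 2 := by
    rw [← lintegral_finsetSum _ fun a _ => hm a,
      ← lintegral_const_mul _ (Finset.measurable_fun_sum _ fun a _ => hm a)]
    exact lintegral_mono fun x => enorm_clm_sq_le _
  calc _ ≤ (∫⁻ x, w x ^ (3 / 2 : ℝ)) ^ (1 / (3 / 2) : ℝ) * eLpNorm u 6 volume ^ 2 := by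
        rw [← e6]; exact hH
    _ ≤ (∫⁻ x, w x ^ (3 / 2 : ℝ)) ^ (1 / (3 / 2) : ℝ) * (C * eLpNorm (fderiv ℝ u) 2 volume) ^ 2 := by
        gcongr
    _ ≤ (∫⁻ x, w x ^ (3 / 2 : ℝ)) ^ (1 / (3 / 2) : ℝ) * (C ^ 2 *
          (3 * ∑ a : Fin 3, ∫⁻ x, ‖fderiv ℝ u x (EuclideanSpace.single a 1)‖ₑ ^ 2)) := by
        rw [mul_pow, e2]; gcongr
    _ = _ := by
        rw [show (1 / (3 / 2) : ℝ) = 2 / 3 by norm_num, sobolevConst]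
        ring

/-- Freeze all particles but the first, apply the inequality on each slice, and integrate over the
frozen variables; the constant does not depend on the slice. -/
theorem lintegral_config_mul_sq_le_fderiv {n : ℕ} {u : Config (n + 1) → ℂ} (hu : ContDiff ℝ 1 u)
    (hc : HasCompactSupport u) {w : Point → ℝ≥0∞} (hw : Measurable w) :
    ∫⁻ r, w (r 0) * ‖u r‖ₑ ^ 2 ≤ sobolevConst * (∫⁻ x, w x ^ (3 / 2 : ℝ)) ^ (2 / 3 : ℝ) *
      ∑ a : Fin 3, ∫⁻ r, ‖fderiv ℝ u r (unitVec 0 a)‖ₑ ^ 2 := by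
  have hm : ∀ a : Fin 3, Measurable fun r => ‖fderiv ℝ u r (unitVec 0 a)‖ₑ ^ 2 :=
    fun a => (((hu.continuous_fderiv one_ne_zero).clm_apply
      continuous_const).measurable.enorm.pow_const 2)
  have hl : Measurable fun r : Config (n + 1) => w (r 0) * ‖u r‖ₑ ^ 2 :=
    (hw.comp (measurable_pi_apply 0)).mul (hu.continuous.measurable.enorm.pow_const 2)
  let J : Point →L[ℝ] Config (n + 1) := ContinuousLinearMap.single ℝ (fun _ => Point) 0
  have hcons : ∀ (y : Config n) (x : Point),
      (Fin.cons x y : Config (n + 1)) = J x + Fin.cons 0 y := by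
    intro y x
    funext i
    refine Fin.cases ?_ (fun j => ?_) i <;> simp [J]
  -- The opaque offset `c` keeps later rewriting from looping on `Fin.cons 0 y`.
  have hcons' : ∀ y : Config n, ∃ c : Config (n + 1), ∀ x : Point,
      (Fin.cons x y : Config (n + 1)) = J x + c := fun y => ⟨_, hcons y⟩
  have hJ : ∀ a, J (EuclideanSpace.single a 1) = unitVec 0 a := fun a => rfl
  have hslice : ∀ y : Config n, ∫⁻ x : Point, w x * ‖u (Fin.cons x y : Config (n + 1))‖ₑ ^ 2 ≤
      sobolevConst * (∫⁻ x, w x ^ (3 / 2 : ℝ)) ^ (2 / 3 : ℝ) *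
      ∑ a : Fin 3, ∫⁻ x : Point,
        ‖fderiv ℝ u (Fin.cons x y : Config (n + 1)) (unitVec 0 a)‖ₑ ^ 2 := by
    intro y
    obtain ⟨c, hy⟩ := hcons' y
    have hd : ContDiff ℝ 1 fun x : Point => u (Fin.cons x y : Config (n + 1)) := by
      simp only [hy]
      exact hu.comp (J.contDiff.add contDiff_const)
    have hcs : HasCompactSupport fun x : Point => u (Fin.cons x y : Config (n + 1)) := by
      refine HasCompactSupport.of_support_subset_isCompact
        (hc.isCompact.image (continuous_apply (0 : Fin (n + 1)))) fun x hx => ?_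
      exact ⟨Fin.cons x y, subset_tsupport _ hx, by simp⟩
    have hf : ∀ x a, fderiv ℝ (fun x : Point => u (Fin.cons x y : Config (n + 1))) x
        (EuclideanSpace.single a 1) = fderiv ℝ u (Fin.cons x y : Config (n + 1)) (unitVec 0 a) := by
      intro x a
      have h1 : HasFDerivAt (fun x : Point => u (Fin.cons x y : Config (n + 1)))
          ((fderiv ℝ u (Fin.cons x y : Config (n + 1))).comp J) x := by
        simp only [hy]
        exact ((hu.differentiable one_ne_zero) _).hasFDerivAt.comp x
          (J.hasFDerivAt.add_const _)
      rw [h1.fderiv, ContinuousLinearMap.comp_apply, hJ]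
    have := lintegral_mul_sq_le_fderiv hd hcs hw
    simpa only [hf] using this
  rw [lintegral_config_succ' hl.aemeasurable]
  simp only [lintegral_config_succ' (hm _).aemeasurable, Fin.cons_zero]
  refine (lintegral_mono hslice).trans (le_of_eq ?_)
  have hma : ∀ a : Fin 3, Measurable fun y : Config n => ∫⁻ x : Point,
      ‖fderiv ℝ u (Fin.cons x y : Config (n + 1)) (unitVec 0 a)‖ₑ ^ 2 := fun a =>
    Measurable.lintegral_prod_left' (f := fun p : Point × Config n =>
      ‖fderiv ℝ u (Fin.cons p.1 p.2 : Config (n + 1)) (unitVec 0 a)‖ₑ ^ 2)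
      ((hm a).comp (measurableEmbedding_cons n).measurable)
  rw [lintegral_const_mul _ (Finset.measurable_fun_sum _ fun a _ => hma a),
    lintegral_finsetSum _ fun a _ => hma a]

end Sobolev

/-! ### Extension of the Sobolev inequality to `H¹` by mollification and cutoff. -/

section SobolevWeak

open ContinuousLinearMap Filter
open scoped Convolution Topology

theorem lintegral_enorm_sq_ne_top {α : Type*} [MeasurableSpace α] {μ : Measure α} {f : α → ℂ}
    (hf : MemLp f 2 μ) : ∫⁻ x, ‖f x‖ₑ ^ 2 ∂μ ≠ ⊤ := by
  have h := lintegral_rpow_enorm_lt_top_of_eLpNorm_lt_top (by norm_num) (by norm_num) hf.2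
  simpa using h.ne

theorem enorm_add_sq_le (x y : ℂ) : ‖x + y‖ₑ ^ 2 ≤ 2 * ‖x‖ₑ ^ 2 + 2 * ‖y‖ₑ ^ 2 := by
  have hr : ‖x + y‖ ^ 2 ≤ 2 * ‖x‖ ^ 2 + 2 * ‖y‖ ^ 2 := by
    have := norm_add_le x y
    nlinarith [sq_nonneg (‖x‖ - ‖y‖), norm_nonneg (x + y)]
  have := ENNReal.ofReal_le_ofReal hr
  rw [ENNReal.ofReal_add (by positivity) (by positivity), ENNReal.ofReal_mul (by norm_num),
    ENNReal.ofReal_mul (by norm_num)] at this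
  simpa [ENNReal.ofReal_pow, ofReal_norm] using this

theorem norm_unitVec {N : ℕ} (i : Fin N) (a : Fin 3) : ‖unitVec i a‖ = 1 := by
  simp [unitVec, Pi.norm_single]

variable {N : ℕ}

/-- Bumps on `ℝ^{3N}` shrinking to the origin. -/
noncomputable def shrinkingBump (N k : ℕ) : ContDiffBump (0 : Config N) where
  rIn := ((k : ℝ) + 1)⁻¹ / 2
  rOut := ((k : ℝ) + 1)⁻¹
  rIn_pos := by positivity
  rIn_lt_rOut := by
    have : 0 < ((k : ℝ) + 1)⁻¹ := by positivity
    linarith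

/-- The mollification of `f` at scale `1 / (k + 1)`. -/
noncomputable def mollify (k : ℕ) (f : Config N → ℂ) : Config N → ℂ :=
  (shrinkingBump N k).normed volume ⋆[lsmul ℝ ℝ, volume] f

theorem contDiff_mollify {f : Config N → ℂ} (hf : LocallyIntegrable f volume) (k : ℕ) :
    ContDiff ℝ 1 (mollify k f) :=
  (shrinkingBump N k).hasCompactSupport_normed.contDiff_convolution_left (n := 1) _
    (shrinkingBump N k).contDiff_normed hf

theorem fderiv_mollify {i : Fin N} {a : Fin 3} {f g : Config N → ℂ}
    (hf : LocallyIntegrable f volume) (h : HasWeakPartial i a f g) (k : ℕ) (r : Config N) :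
    fderiv ℝ (mollify k f) r (unitVec i a) = mollify k g r :=
  fderiv_convolution_eq (shrinkingBump N k).contDiff_normed
    (shrinkingBump N k).hasCompactSupport_normed hf h r

theorem lintegral_mollify_sq_le {f : Config N → ℂ} (hf : AEStronglyMeasurable f volume) (k : ℕ) :
    ∫⁻ r, ‖mollify k f r‖ₑ ^ 2 ≤ ∫⁻ r, ‖f r‖ₑ ^ 2 :=
  lintegral_sq_convolution_le (shrinkingBump N k).continuous_normed
    (shrinkingBump N k).nonneg_normed (lintegral_ofReal_normed_eq_one _) hf

theorem tendsto_mollify {f : Config N → ℂ} (hf : LocallyIntegrable f volume) :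
    ∀ᵐ r, Tendsto (fun k => mollify k f r) atTop (𝓝 (f r)) := by
  refine ContDiffBump.ae_convolution_tendsto_right_of_locallyIntegrable (K := 2) ?_ ?_ hf
  · simpa [one_div, shrinkingBump] using tendsto_one_div_add_atTop_nhds_zero_nat (𝕜 := ℝ)
  · refine Eventually.of_forall fun k => ?_
    simp only [shrinkingBump]
    linarith

/-- A cutoff equal to `1` on the ball of radius `k + 1`. -/
noncomputable def cutoff (k : ℕ) (r : Config N) : ℝ :=
  (⟨1, 2, one_pos, one_lt_two⟩ : ContDiffBump (0 : Config N)) (((k : ℝ) + 1)⁻¹ • r)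

theorem contDiff_cutoff (k : ℕ) : ContDiff ℝ 1 (cutoff k : Config N → ℝ) :=
  (ContDiffBump.contDiff _).comp (contDiff_const_smul _)

theorem hasCompactSupport_cutoff (k : ℕ) : HasCompactSupport (cutoff k : Config N → ℝ) :=
  (ContDiffBump.hasCompactSupport _).comp_smul (by positivity)

theorem enorm_cutoff_le_one (k : ℕ) (r : Config N) : ‖cutoff k r‖ₑ ≤ 1 := by
  rw [cutoff, Real.enorm_of_nonneg (ContDiffBump.nonneg _), ← ENNReal.ofReal_one]
  exact ENNReal.ofReal_le_ofReal (ContDiffBump.le_one _)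

theorem tendsto_cutoff (r : Config N) : Tendsto (fun k => cutoff k r) atTop (𝓝 1) := by
  have h : Tendsto (fun k : ℕ => ((k : ℝ) + 1)⁻¹ • r) atTop (𝓝 0) := by
    have := (tendsto_one_div_add_atTop_nhds_zero_nat (𝕜 := ℝ)).smul_const r
    simpa [one_div] using this
  have h2 := (ContDiffBump.continuous
    (⟨1, 2, one_pos, one_lt_two⟩ : ContDiffBump (0 : Config N))).continuousAt.tendsto.comp h
  have h1 : (⟨1, 2, one_pos, one_lt_two⟩ : ContDiffBump (0 : Config N)) 0 = 1 :=
    ContDiffBump.one_of_mem_closedBall _ (by simp)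
  rw [h1] at h2
  exact h2

theorem exists_enorm_fderiv_cutoff_le (N : ℕ) : ∃ L : ℝ≥0∞, L ≠ ⊤ ∧
    ∀ (k : ℕ) (r : Config N) (i : Fin N) (a : Fin 3),
      ‖fderiv ℝ (cutoff k) r (unitVec i a)‖ₑ ≤ ENNReal.ofReal ((k : ℝ) + 1)⁻¹ * L := by
  set χ : ContDiffBump (0 : Config N) := ⟨1, 2, one_pos, one_lt_two⟩
  have hχ : ContDiff ℝ 1 χ := χ.contDiff
  obtain ⟨L, hL⟩ := (χ.hasCompactSupport.fderiv ℝ).exists_bound_of_continuous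
    (hχ.continuous_fderiv one_ne_zero)
  refine ⟨ENNReal.ofReal L, ENNReal.ofReal_ne_top, fun k r i a => ?_⟩
  have h1 : fderiv ℝ (cutoff k) r = ((k : ℝ) + 1)⁻¹ • fderiv ℝ χ (((k : ℝ) + 1)⁻¹ • r) :=
    fderiv_comp_smul (f := χ) _
  have hn : ‖fderiv ℝ (cutoff k) r (unitVec i a)‖ ≤ ((k : ℝ) + 1)⁻¹ * L := by
    refine (le_opNorm _ _).trans ?_
    rw [norm_unitVec, mul_one, h1, norm_smul, Real.norm_of_nonneg (by positivity)]
    gcongr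
    exact hL _
  rw [← ENNReal.ofReal_mul (by positivity), ← ofReal_norm]
  exact ENNReal.ofReal_le_ofReal hn

/-- Weighted Sobolev inequality for functions of finite kinetic energy, in the variables of the
first particle. -/
theorem lintegral_mul_sq_le_weakPartial {n : ℕ} {f : Config (n + 1) → ℂ}
    {g : Fin 3 → Config (n + 1) → ℂ} (hf : MemLp f 2 volume) (hg : ∀ a, MemLp (g a) 2 volume)
    (h : ∀ a, HasWeakPartial 0 a f (g a)) {w : Point → ℝ≥0∞} (hw : Measurable w)
    (hwt : ∀ x, w x ≠ ⊤) (hwi : ∫⁻ x, w x ^ (3 / 2 : ℝ) ≠ ⊤) :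
    ∫⁻ r, w (r 0) * ‖f r‖ₑ ^ 2 ≤ sobolevConst * (∫⁻ x, w x ^ (3 / 2 : ℝ)) ^ (2 / 3 : ℝ) *
      (2 * ∑ a : Fin 3, ∫⁻ r, ‖g a r‖ₑ ^ 2) := by
  have hfl := locallyIntegrable_of_memLp_two hf
  set A := sobolevConst * (∫⁻ x, w x ^ (3 / 2 : ℝ)) ^ (2 / 3 : ℝ)
  have hA : A ≠ ⊤ := ENNReal.mul_ne_top sobolevConst_ne_top
    (ENNReal.rpow_ne_top_of_nonneg (by norm_num) hwi)
  obtain ⟨L, hLt, hL⟩ := exists_enorm_fderiv_cutoff_le (n + 1)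
  -- Mollify, then cut off. The gradient that falls on the cutoff is `O(1 / (k + 1))` and disappears
  -- in the limit.
  set U : ℕ → Config (n + 1) → ℂ := fun k r => cutoff k r • mollify k f r
  have hU : ∀ k, ContDiff ℝ 1 (U k) := fun k => (contDiff_cutoff k).smul (contDiff_mollify hfl k)
  have hUc : ∀ k, HasCompactSupport (U k) := fun k => (hasCompactSupport_cutoff k).smul_right
  have hdU : ∀ k r a, ‖fderiv ℝ (U k) r (unitVec 0 a)‖ₑ ^ 2 ≤
      2 * ‖mollify k (g a) r‖ₑ ^ 2 +
        2 * ((ENNReal.ofReal ((k : ℝ) + 1)⁻¹ * L) ^ 2 * ‖mollify k f r‖ₑ ^ 2) := by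
    intro k r a
    have e : fderiv ℝ (U k) r (unitVec 0 a) = cutoff k r • mollify k (g a) r +
        fderiv ℝ (cutoff k) r (unitVec 0 a) • mollify k f r := by
      have h1 := (((contDiff_cutoff k).differentiable one_ne_zero) r).hasFDerivAt.smul
        (((contDiff_mollify hfl k).differentiable one_ne_zero) r).hasFDerivAt
      have h2 : fderiv ℝ (U k) r = _ := h1.fderiv
      rw [h2]
      simp [fderiv_mollify hfl (h a) k r]
    rw [e]
    refine (enorm_add_sq_le _ _).trans ?_
    rw [enorm_smul, enorm_smul, ← mul_pow]
    gcongr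
    · exact mul_le_of_le_one_left' (enorm_cutoff_le_one k r)
    · exact hL k r 0 a
  have hbound : ∀ k, ∫⁻ r, w (r 0) * ‖U k r‖ₑ ^ 2 ≤ A * ∑ a : Fin 3,
      (2 * (∫⁻ r, ‖g a r‖ₑ ^ 2) +
        2 * ((ENNReal.ofReal ((k : ℝ) + 1)⁻¹ * L) ^ 2 * ∫⁻ r, ‖f r‖ₑ ^ 2)) := by
    intro k
    refine (lintegral_config_mul_sq_le_fderiv (hU k) (hUc k) hw).trans ?_
    gcongr with a
    refine (lintegral_mono fun r => hdU k r a).trans ?_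
    have hmf : Measurable fun r => ‖mollify k f r‖ₑ ^ 2 :=
      (contDiff_mollify hfl k).continuous.measurable.enorm.pow_const 2
    have hmg : Measurable fun r => ‖mollify k (g a) r‖ₑ ^ 2 :=
      (contDiff_mollify (locallyIntegrable_of_memLp_two
        (hg a)) k).continuous.measurable.enorm.pow_const 2
    rw [lintegral_add_left (hmg.const_mul 2), lintegral_const_mul 2 hmg,
      lintegral_const_mul 2 (hmf.const_mul _), lintegral_const_mul _ hmf]
    exact add_le_add (mul_le_mul_right (lintegral_mollify_sq_le (hg a).1 k) 2)
      (mul_le_mul_right (mul_le_mul_right (lintegral_mollify_sq_le hf.1 k) _) 2)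
  have hpt : ∀ᵐ r : Config (n + 1),
      Tendsto (fun k => w (r 0) * ‖U k r‖ₑ ^ 2) atTop (𝓝 (w (r 0) * ‖f r‖ₑ ^ 2)) := by
    filter_upwards [tendsto_mollify hfl] with r hr
    have h1 : Tendsto (fun k => U k r) atTop (𝓝 ((1 : ℝ) • f r)) := (tendsto_cutoff r).smul hr
    rw [one_smul] at h1
    exact ENNReal.Tendsto.const_mul (ENNReal.Tendsto.pow h1.enorm) (Or.inr (hwt _))
  have hlim : Tendsto (fun k : ℕ => A * ∑ a : Fin 3,
      (2 * (∫⁻ r, ‖g a r‖ₑ ^ 2) +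
        2 * ((ENNReal.ofReal ((k : ℝ) + 1)⁻¹ * L) ^ 2 * ∫⁻ r, ‖f r‖ₑ ^ 2))) atTop
      (𝓝 (A * ∑ a : Fin 3, (2 * (∫⁻ r, ‖g a r‖ₑ ^ 2) + 0))) := by
    refine ENNReal.Tendsto.const_mul (tendsto_finsetSum _ fun a _ => tendsto_const_nhds.add ?_)
      (Or.inr hA)
    have h0 : Tendsto (fun k : ℕ => ENNReal.ofReal ((k : ℝ) + 1)⁻¹) atTop (𝓝 0) := by
      rw [← ENNReal.ofReal_zero]
      refine ENNReal.tendsto_ofReal ?_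
      simpa [one_div] using tendsto_one_div_add_atTop_nhds_zero_nat (𝕜 := ℝ)
    have h1 := ENNReal.Tendsto.mul_const h0 (b := L) (Or.inr hLt)
    have h2 := ENNReal.Tendsto.mul_const (ENNReal.Tendsto.pow (n := 2) h1) (b := ∫⁻ r, ‖f r‖ₑ ^ 2)
      (Or.inr (lintegral_enorm_sq_ne_top hf))
    have h3 := ENNReal.Tendsto.const_mul h2 (a := 2) (Or.inr (by norm_num))
    simpa using h3
  -- Fatou, since only a.e. convergence of `U k` is at hand. The factor `2` from `enorm_add_sq_le`
  -- survives the limit.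
  calc ∫⁻ r, w (r 0) * ‖f r‖ₑ ^ 2
      = ∫⁻ r, liminf (fun k => w (r 0) * ‖U k r‖ₑ ^ 2) atTop :=
        lintegral_congr_ae (hpt.mono fun r hr => hr.liminf_eq.symm)
    _ ≤ liminf (fun k => ∫⁻ r, w (r 0) * ‖U k r‖ₑ ^ 2) atTop :=
        lintegral_liminf_le fun k => (hw.comp (measurable_pi_apply 0)).mul
          ((hU k).continuous.measurable.enorm.pow_const 2)
    _ ≤ liminf (fun k : ℕ => A * ∑ a : Fin 3, (2 * (∫⁻ r, ‖g a r‖ₑ ^ 2) +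
        2 * ((ENNReal.ofReal ((k : ℝ) + 1)⁻¹ * L) ^ 2 * ∫⁻ r, ‖f r‖ₑ ^ 2))) atTop :=
        liminf_le_liminf (Eventually.of_forall hbound)
    _ = A * (2 * ∑ a : Fin 3, ∫⁻ r, ‖g a r‖ₑ ^ 2) := by
        rw [hlim.liminf_eq]
        simp only [add_zero, Finset.mul_sum]

end SobolevWeak

/-! ### Consequences: vanishing gradients, and splitting of potentials. -/

section KineticEnergy

open Filter
open scoped Topology

variable {n : ℕ}

/-- Taking as weight the indicator of the ball of radius `m` kills `f` wherever the first particle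
lies in that ball; then let `m` run through `ℕ`. -/
theorem ae_eq_zero_of_hasWeakPartial_zero {f : Config (n + 1) → ℂ}
    {g : Fin 3 → Config (n + 1) → ℂ} (hf : MemLp f 2 volume) (hg : ∀ a, MemLp (g a) 2 volume)
    (h : ∀ a, HasWeakPartial 0 a f (g a)) (h0 : ∀ a, ∫⁻ r, ‖g a r‖ₑ ^ 2 = 0) :
    f =ᵐ[volume] 0 := by
  have key : ∀ m : ℕ, ∀ᵐ r : Config (n + 1),
      (Metric.ball (0 : Point) m).indicator (1 : Point → ℝ≥0∞) (r 0) * ‖f r‖ₑ ^ 2 = 0 := by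
    intro m
    set w : Point → ℝ≥0∞ := (Metric.ball (0 : Point) m).indicator 1
    have hw : Measurable w := measurable_one.indicator Metric.isOpen_ball.measurableSet
    have hw1 : ∀ x, w x ≤ 1 := fun x => Set.indicator_le_self' (fun _ _ => zero_le) x
    have hwr : ∀ x, w x ^ (3 / 2 : ℝ) = w x := by
      intro x
      by_cases hx : x ∈ Metric.ball (0 : Point) m <;>
        simp [w, hx, ENNReal.zero_rpow_of_pos]
    have hwi : ∫⁻ x, w x ^ (3 / 2 : ℝ) ≠ ⊤ := by
      simp only [hwr, w]
      rw [lintegral_indicator_one Metric.isOpen_ball.measurableSet]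
      exact measure_ball_lt_top.ne
    have := lintegral_mul_sq_le_weakPartial hf hg h hw
      (fun x => ((hw1 x).trans_lt ENNReal.one_lt_top).ne) hwi
    simp only [h0, Finset.sum_const_zero, mul_zero, nonpos_iff_eq_zero] at this
    have hm : AEMeasurable (fun r : Config (n + 1) => w (r 0) * ‖f r‖ₑ ^ 2) volume :=
      (hw.comp (measurable_pi_apply 0)).aemeasurable.mul (hf.1.enorm.pow_const 2)
    exact (lintegral_eq_zero_iff' hm).1 this
  filter_upwards [ae_all_iff.2 key] with r hr
  obtain ⟨m, hm⟩ := exists_nat_gt ‖r 0‖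
  have := hr m
  rw [Set.indicator_of_mem (by simpa using hm)] at this
  simpa using this

/-- Let `w` be `v` restricted to `{v > K}`. There `v ^ (3/2) = v ^ (-1/2) * v ^ 2 ≤ K ^ (-1/2) * v ^
2`, so `‖w‖_{3/2}` tends to `0` as `K` grows. The trailing factor `2` is the one in
`lintegral_mul_sq_le_weakPartial`. -/
theorem exists_bounded_add_small {v : Point → ℝ≥0∞} (hv : Measurable v) (hvt : ∀ x, v x ≠ ⊤)
    (hv2 : ∫⁻ x, v x ^ 2 ≠ ⊤) {ε : ℝ≥0∞} (hε : ε ≠ 0) :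
    ∃ (M : ℝ≥0∞) (w : Point → ℝ≥0∞), M ≠ ⊤ ∧ Measurable w ∧ (∀ x, w x ≠ ⊤) ∧
      (∀ x, v x ≤ M + w x) ∧ ∫⁻ x, w x ^ (3 / 2 : ℝ) ≠ ⊤ ∧
      sobolevConst * (∫⁻ x, w x ^ (3 / 2 : ℝ)) ^ (2 / 3 : ℝ) * 2 ≤ ε := by
  have hlim : Tendsto (fun k : ℕ => sobolevConst *
      ((((k + 1 : ℕ) : ℝ≥0∞)⁻¹ ^ (1 / 2 : ℝ)) * ∫⁻ x, v x ^ 2) ^ (2 / 3 : ℝ) * 2) atTop (𝓝 0) := by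
    have h1 : Tendsto (fun k : ℕ => (((k + 1 : ℕ) : ℝ≥0∞)⁻¹)) atTop (𝓝 0) :=
      ENNReal.tendsto_inv_nat_nhds_zero.comp (tendsto_add_atTop_nat 1)
    have h2 := ((ENNReal.continuous_rpow_const (y := 1 / 2)).tendsto 0).comp h1
    have h3 := ENNReal.Tendsto.mul_const h2 (b := ∫⁻ x, v x ^ 2) (Or.inr hv2)
    have h4 := ((ENNReal.continuous_rpow_const (y := 2 / 3)).tendsto _).comp h3
    have h5 := ENNReal.Tendsto.mul_const (ENNReal.Tendsto.const_mul h4 (Or.inr sobolevConst_ne_top))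
      (b := 2) (Or.inr (by norm_num))
    simpa using h5
  obtain ⟨k, hk⟩ := (hlim.eventually (ge_mem_nhds (pos_iff_ne_zero.2 hε))).exists
  set K : ℝ≥0∞ := ((k + 1 : ℕ) : ℝ≥0∞)
  have hS : MeasurableSet {x | K < v x} := measurableSet_lt measurable_const hv
  set w : Point → ℝ≥0∞ := {x | K < v x}.indicator v
  have hwle : ∀ x, w x ≤ v x := Set.indicator_le_self' fun _ _ => zero_le
  have hint : ∫⁻ x, w x ^ (3 / 2 : ℝ) ≤ (K⁻¹ ^ (1 / 2 : ℝ)) * ∫⁻ x, v x ^ 2 := by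
    rw [← lintegral_const_mul _ (hv.pow_const 2)]
    refine lintegral_mono fun x => ?_
    by_cases hx : K < v x
    · have hwx : w x = v x := Set.indicator_of_mem (s := {x | K < v x}) hx v
      have hv0 : v x ≠ 0 := (pos_of_gt hx).ne'
      have e : v x ^ (3 / 2 : ℝ) = (v x)⁻¹ ^ (1 / 2 : ℝ) * v x ^ 2 := by
        rw [← ENNReal.rpow_two, ENNReal.inv_rpow, ← ENNReal.rpow_neg,
          ← ENNReal.rpow_add _ _ hv0 (hvt x)]
        norm_num
      simp only [hwx, e]
      gcongr
    · have hwx : w x = 0 := Set.indicator_of_notMem (s := {x | K < v x}) hx v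
      simp [hwx]
  have hKi : K⁻¹ ≠ ⊤ := ENNReal.inv_ne_top.2 (by simp [K])
  refine ⟨K, w, ENNReal.natCast_ne_top _, hv.indicator hS,
    fun x => ((hwle x).trans_lt (hvt x).lt_top).ne, fun x => ?_, ?_, ?_⟩
  · by_cases hx : K < v x
    · have hwx : w x = v x := Set.indicator_of_mem (s := {x | K < v x}) hx v
      rw [hwx]; exact le_add_self
    · exact (not_lt.1 hx).trans le_self_add
  · exact (hint.trans_lt (ENNReal.mul_lt_top
      (ENNReal.rpow_lt_top_of_nonneg (by norm_num) hKi) hv2.lt_top)).ne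
  · refine le_trans ?_ hk
    gcongr

end KineticEnergy

/-! ### One-particle densities and form boundedness. -/

section Density

variable {n : ℕ}

theorem aemeasurable_density {ψ : WaveFunction (n + 1)}
    (hψ : ∀ s, AEStronglyMeasurable (ψ s) volume) : AEMeasurable (density ψ) volume := by
  unfold density
  refine AEMeasurable.const_mul (Finset.aemeasurable_fun_sum _ fun s _ => ?_) _
  exact (aemeasurable_cons ((hψ s).enorm.pow_const 2)).lintegral_prod_right'

theorem lintegral_density_mul {ψ : WaveFunction (n + 1)}
    (hψ : ∀ s, AEStronglyMeasurable (ψ s) volume) {v : Point → ℝ≥0∞} (hv : Measurable v)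
    (hvt : ∀ x, v x ≠ ⊤) :
    ∫⁻ x, density ψ x * v x =
      ((n + 1 : ℕ) : ℝ≥0∞) * ∑ s, ∫⁻ r : Config (n + 1), v (r 0) * ‖ψ s r‖ₑ ^ 2 := by
  have hm : ∀ s, AEMeasurable (fun r : Config (n + 1) => v (r 0) * ‖ψ s r‖ₑ ^ 2) volume :=
    fun s => (hv.comp (measurable_pi_apply 0)).aemeasurable.mul ((hψ s).enorm.pow_const 2)
  have hms : ∀ s, AEMeasurable (fun x : Point => v x *
      ∫⁻ y : Config n, ‖ψ s (Fin.cons x y : Config (n + 1))‖ₑ ^ 2) volume := fun s =>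
    hv.aemeasurable.mul (aemeasurable_cons ((hψ s).enorm.pow_const 2)).lintegral_prod_right'
  have hin : ∀ s (x : Point), ∫⁻ y : Config n, v x * ‖ψ s (Fin.cons x y : Config (n + 1))‖ₑ ^ 2 =
      v x * ∫⁻ y : Config n, ‖ψ s (Fin.cons x y : Config (n + 1))‖ₑ ^ 2 :=
    fun s x => lintegral_const_mul' _ _ (hvt x)
  simp only [fun s => lintegral_config_succ (hm s), Fin.cons_zero, hin]
  rw [← lintegral_finsetSum' _ fun s _ => hms s,
    ← lintegral_const_mul'' _ (Finset.aemeasurable_fun_sum _ fun s _ => hms s)]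
  refine lintegral_congr fun x => ?_
  simp only [density, ← Finset.mul_sum]
  ring

theorem lintegral_density {ψ : WaveFunction (n + 1)} (hψ : ψ ∈ WN (n + 1)) :
    ∫⁻ x, density ψ x = ((n + 1 : ℕ) : ℝ≥0∞) := by
  have h := lintegral_density_mul (fun s => (hψ.1.1 s).1.1) (v := 1) measurable_one
    fun _ => ENNReal.one_ne_top
  simpa [hψ.2] using h

/-- Square-integrable potentials are form bounded with respect to the internal energy. -/
theorem exists_lintegral_density_mul_le (n : ℕ) {v : Point → ℝ≥0∞} (hv : Measurable v)
    (hvt : ∀ x, v x ≠ ⊤) (hv2 : ∫⁻ x, v x ^ 2 ≠ ⊤) :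
    ∃ C : ℝ≥0∞, C ≠ ⊤ ∧ ∀ ψ ∈ WN (n + 1), ∫⁻ x, density ψ x * v x ≤ C + internalEnergy ψ := by
  have hn0 : ((n + 1 : ℕ) : ℝ≥0∞) ≠ 0 := by simp
  have hnt : ((n + 1 : ℕ) : ℝ≥0∞) ≠ ⊤ := ENNReal.natCast_ne_top _
  obtain ⟨M, w, hM, hw, hwt, hvw, hwi, hε⟩ := exists_bounded_add_small hv hvt hv2
    -- The inverse of `n + 1` cancels the prefactor of the density, and `2⁻¹` is the coefficient of
    -- the kinetic energy.
    (ε := ((n + 1 : ℕ) : ℝ≥0∞)⁻¹ * 2⁻¹)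
    (mul_ne_zero (ENNReal.inv_ne_zero.2 hnt) (by simp))
  refine ⟨((n + 1 : ℕ) : ℝ≥0∞) * M, ENNReal.mul_ne_top hnt hM, fun ψ hψ => ?_⟩
  have hm : ∀ s, AEStronglyMeasurable (ψ s) volume := fun s => (hψ.1.1 s).1.1
  rw [lintegral_density_mul hm hv hvt]
  have hs : ∀ s, ∫⁻ r : Config (n + 1), v (r 0) * ‖ψ s r‖ₑ ^ 2 ≤ M * (∫⁻ r, ‖ψ s r‖ₑ ^ 2) +
      ((n + 1 : ℕ) : ℝ≥0∞)⁻¹ * 2⁻¹ * ∑ i, ∑ a, ∫⁻ r, ‖weakPartial i a (ψ s) r‖ₑ ^ 2 := by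
    intro s
    have h1 := lintegral_mul_sq_le_weakPartial (hψ.1.1 s).1
      (fun a => memLp_weakPartial 0 a (ψ s)) (fun a => (hψ.1.1 s).hasWeakPartial 0 a) hw hwt hwi
    calc ∫⁻ r : Config (n + 1), v (r 0) * ‖ψ s r‖ₑ ^ 2
        ≤ ∫⁻ r : Config (n + 1), (M * ‖ψ s r‖ₑ ^ 2 + w (r 0) * ‖ψ s r‖ₑ ^ 2) := by
          refine lintegral_mono fun r => ?_
          rw [← add_mul]
          exact mul_le_mul_left (hvw _) _
      _ = M * (∫⁻ r, ‖ψ s r‖ₑ ^ 2) + ∫⁻ r : Config (n + 1), w (r 0) * ‖ψ s r‖ₑ ^ 2 := by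
          rw [lintegral_add_left' (((hm s).enorm.pow_const 2).const_mul M),
            lintegral_const_mul' _ _ hM]
      _ ≤ _ := by
          refine add_le_add_right (h1.trans ?_) _
          rw [← mul_assoc]
          refine mul_le_mul' hε ?_
          exact Finset.single_le_sum (f := fun i => ∑ a, ∫⁻ r, ‖weakPartial i a (ψ s) r‖ₑ ^ 2)
            (fun _ _ => zero_le) (Finset.mem_univ 0)
  refine (mul_le_mul_right (Finset.sum_le_sum fun s _ => hs s) _).trans ?_
  rw [Finset.sum_add_distrib, ← Finset.mul_sum, ← Finset.mul_sum, hψ.2, mul_one, mul_add,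
    ← mul_assoc, ← mul_assoc, ENNReal.mul_inv_cancel hn0 hnt, one_mul]
  exact add_le_add_right le_self_add _

end Density

/-! ### Bounds for `E` from below, and `FDM` at zero. -/

section GroundStateEnergy

variable {n : ℕ}

theorem DensityOperator.HasDensity.ae_eq {N : ℕ} {γ : DensityOperator N} {ρ : L2}
    (h : γ.HasDensity ρ) : ∀ᵐ r : Point,
      0 ≤ ρ r ∧ ‖ρ r‖ₑ = ∑' k, γ.weight k * density (γ.state k) r := by
  filter_upwards [h] with r hr
  have h0 : 0 ≤ ρ r := by
    have := EReal.coe_ennreal_nonneg (∑' k, γ.weight k * density (γ.state k) r)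
    rw [hr] at this
    exact_mod_cast this
  refine ⟨h0, ?_⟩
  rw [Real.enorm_of_nonneg h0, ← EReal.coe_ennreal_eq_coe_ennreal_iff, hr, EReal.coe_ennreal_ofReal,
    max_eq_left h0]

/-- Tonelli for the sum over states. States of weight zero are arbitrary, perhaps not measurable,
and are treated apart. -/
theorem DensityOperator.lintegral_density_mul {γ : DensityOperator (n + 1)} {ρ : L2}
    (h : γ.HasDensity ρ) {v : Point → ℝ≥0∞} (hv : Measurable v) :
    ∫⁻ x, ‖ρ x‖ₑ * v x = ∑' k, γ.weight k * ∫⁻ x, density (γ.state k) x * v x := by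
  have hm : ∀ k, AEMeasurable (fun x => γ.weight k * (density (γ.state k) x * v x)) volume := by
    intro k
    by_cases hk : γ.weight k = 0
    · simp [hk]
    · exact ((aemeasurable_density fun s => ((γ.state_mem k hk).1.1 s).1.1).mul
        hv.aemeasurable).const_mul _
  have hw : ∀ k, γ.weight k ≠ ⊤ := fun k =>
    ((ENNReal.le_tsum k).trans_lt (γ.tsum_weight.trans_lt ENNReal.one_lt_top)).ne
  simp only [fun k => (lintegral_const_mul' (μ := (volume : Measure Point)) (γ.weight k)
    (fun x => density (γ.state k) x * v x) (hw k)).symm]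
  rw [← lintegral_tsum hm]
  refine lintegral_congr_ae ?_
  filter_upwards [h.ae_eq] with x hx
  rw [hx.2, ← ENNReal.tsum_mul_right]
  simp only [mul_assoc]

/-- The form bound, averaged over the states: the weights sum to `1`, so the constant is independent
of `γ` and `ρ`. -/
theorem exists_neg_inner_le_traceH0 (v : L2) : ∃ C : ℝ≥0∞, C ≠ ⊤ ∧
    ∀ (γ : DensityOperator (n + 1)) (ρ : L2), γ.HasDensity ρ →
      ENNReal.ofReal (-inner ℝ v ρ) ≤ C + γ.traceH0 := by
  have hvm : Measurable fun x => ‖v x‖ₑ := (Lp.stronglyMeasurable v).measurable.enorm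
  have hv2 : ∫⁻ x, ‖v x‖ₑ ^ 2 ≠ ⊤ := by
    have := lintegral_rpow_enorm_lt_top_of_eLpNorm_lt_top (by norm_num) (by norm_num)
      (Lp.memLp v).2
    simpa using this.ne
  obtain ⟨C, hC, h⟩ := exists_lintegral_density_mul_le n hvm (fun x => enorm_ne_top) hv2
  refine ⟨C, hC, fun γ ρ hγ => ?_⟩
  have h1 : ENNReal.ofReal (-inner ℝ v ρ) ≤ ∫⁻ x, ‖ρ x‖ₑ * ‖v x‖ₑ := by
    rw [L2.inner_def]
    calc _ ≤ ‖∫ x, inner ℝ (v x) (ρ x)‖ₑ := by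
          rw [← ofReal_norm]
          exact ENNReal.ofReal_le_ofReal (neg_le_abs _)
      _ ≤ ∫⁻ x, ‖inner ℝ (v x) (ρ x)‖ₑ := enorm_integral_le_lintegral_enorm _
      _ = _ := by simp [enorm_mul]
  refine h1.trans ?_
  rw [DensityOperator.lintegral_density_mul hγ hvm, DensityOperator.traceH0]
  calc _ ≤ ∑' k, (γ.weight k * C + γ.weight k * internalEnergy (γ.state k)) := by
        refine ENNReal.tsum_le_tsum fun k => ?_
        by_cases hk : γ.weight k = 0
        · simp [hk]
        · rw [← mul_add]
          exact mul_le_mul_right (h _ (γ.state_mem k hk)) _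
    _ = _ := by rw [ENNReal.tsum_add, ENNReal.tsum_mul_right, γ.tsum_weight, one_mul]

theorem E_ne_bot (v : L2) : E (n + 1) v ≠ ⊥ := by
  obtain ⟨C, hC, h⟩ := exists_neg_inner_le_traceH0 (n := n) v
  have hle : ((-C.toReal : ℝ) : EReal) ≤ E (n + 1) v := by
    refine le_iInf fun ρ => ?_
    have h1 : ENNReal.ofReal (-inner ℝ v ρ - C.toReal) ≤
        ⨅ (γ : DensityOperator (n + 1)) (_ : γ.HasDensity ρ), γ.traceH0 := by
      refine le_iInf₂ fun γ hγ => ?_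
      rw [ENNReal.ofReal_sub _ ENNReal.toReal_nonneg, ENNReal.ofReal_toReal hC, tsub_le_iff_left]
      exact h γ ρ hγ
    have h2 : ((-inner ℝ v ρ - C.toReal : ℝ) : EReal) ≤ FDM (n + 1) ρ := by
      refine le_trans ?_ (EReal.coe_ennreal_le_coe_ennreal_iff.2 h1)
      rw [EReal.coe_ennreal_ofReal]
      exact_mod_cast le_max_left _ _
    calc ((-C.toReal : ℝ) : EReal)
        = ((-inner ℝ v ρ - C.toReal : ℝ) : EReal) + ((inner ℝ v ρ : ℝ) : EReal) := by
          rw [← EReal.coe_add]; congr 1; ring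
      _ ≤ _ := by gcongr
  exact ((EReal.bot_lt_coe _).trans_le hle).ne'

theorem E_nonneg {N : ℕ} {v : L2} (hv : ∀ᵐ r : Point, 0 ≤ v r) : 0 ≤ E N v := by
  refine le_iInf fun ρ => ?_
  by_cases h : ∃ γ : DensityOperator N, γ.HasDensity ρ
  · obtain ⟨γ, hγ⟩ := h
    refine add_nonneg (EReal.coe_ennreal_nonneg _) (EReal.coe_nonneg.2 ?_)
    rw [L2.inner_def]
    refine integral_nonneg_of_ae ?_
    filter_upwards [hv, hγ.ae_eq] with r h1 h2
    simpa using mul_nonneg h2.1 h1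
  · have : FDM N ρ = ⊤ := by
      rw [FDM]
      simp only [not_exists] at h
      simp [h]
    rw [this, EReal.top_add_coe]
    exact le_top

/-- Every density operator has a density of total mass `n + 1`, so none represents `0`. -/
theorem FDM_zero : FDM (n + 1) 0 = ⊤ := by
  have h : ∀ γ : DensityOperator (n + 1), ¬ γ.HasDensity 0 := by
    intro γ hγ
    have h1 := DensityOperator.lintegral_density_mul hγ (v := 1) measurable_one
    have h2 : ∫⁻ x, ‖(0 : L2) x‖ₑ * (1 : Point → ℝ≥0∞) x = 0 := by simp
    have h3 : ∀ k, γ.weight k * ∫⁻ x, density (γ.state k) x * (1 : Point → ℝ≥0∞) x =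
        γ.weight k * ((n + 1 : ℕ) : ℝ≥0∞) := by
      intro k
      by_cases hk : γ.weight k = 0
      · simp [hk]
      · simp only [Pi.one_apply, mul_one]
        rw [lintegral_density (γ.state_mem k hk)]
    simp only [h3] at h1
    rw [h2, ENNReal.tsum_mul_right, γ.tsum_weight, one_mul] at h1
    exact (Nat.cast_ne_zero.2 n.succ_ne_zero) h1.symm
  rw [FDM]
  simp [h]

end GroundStateEnergy

/-! ### A smooth antisymmetric function with finite Coulomb energy. -/

section SlaterDeterminant

/-- Bumps of radius one around well-separated centres, used as one-particle orbitals. -/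
noncomputable def orbital (N : ℕ) (i : Fin N) :
    ContDiffBump (EuclideanSpace.single (0 : Fin 3) (3 * (i : ℝ)) : Point) :=
  ⟨1 / 2, 1, by norm_num, by norm_num⟩

theorem orbital_ne_zero_iff {N : ℕ} (i : Fin N) (x : Point) :
    orbital N i x ≠ 0 ↔ dist x (EuclideanSpace.single (0 : Fin 3) (3 * (i : ℝ)) : Point) < 1 := by
  rw [← Function.mem_support, (orbital N i).support_eq]
  rfl

theorem three_le_dist_centre {N : ℕ} {i j : Fin N} (h : i ≠ j) :
    3 ≤ dist (EuclideanSpace.single (0 : Fin 3) (3 * (i : ℝ)) : Point)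
      (EuclideanSpace.single (0 : Fin 3) (3 * (j : ℝ))) := by
  have h1 : (1 : ℤ) ≤ |(i : ℤ) - (j : ℤ)| :=
    Int.one_le_abs (sub_ne_zero.2 fun e => h (Fin.ext (by exact_mod_cast e)))
  have h2 : (1 : ℝ) ≤ |(i : ℝ) - (j : ℝ)| := by exact_mod_cast h1
  rw [PiLp.dist_single_same, Real.dist_eq, ← mul_sub, abs_mul, abs_of_pos three_pos]
  linarith

/-- The unnormalized Slater determinant of the orbitals. -/
noncomputable def slater (N : ℕ) (r : Config N) : ℂ :=
  ((Matrix.of fun j i : Fin N => orbital N i (r j)).det : ℝ)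

variable {N : ℕ}

theorem contDiff_slater : ContDiff ℝ 1 (slater N) := by
  have h : ContDiff ℝ 1 fun r : Config N =>
      (Matrix.of fun j i : Fin N => orbital N i (r j)).det := by
    simp only [Matrix.det_apply, Matrix.of_apply]
    refine ContDiff.sum fun σ _ => ContDiff.const_smul _ (contDiff_prod fun i _ => ?_)
    exact (orbital N i).contDiff.comp (contDiff_apply ℝ Point (σ i))
  exact Complex.ofRealCLM.contDiff.comp h

theorem slater_comp_perm (σ : Equiv.Perm (Fin N)) (r : Config N) :
    slater N (r ∘ σ) = ((Equiv.Perm.sign σ : ℤ) : ℂ) * slater N r := by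
  have h := Matrix.det_permute σ (Matrix.of fun j i : Fin N => orbital N i (r j))
  have e : ((Matrix.of fun j i : Fin N => orbital N i (r j)).submatrix σ id) =
      Matrix.of fun j i : Fin N => orbital N i ((r ∘ σ) j) := rfl
  rw [e] at h
  rw [slater, h, slater]
  push_cast
  rfl

/-- Some term of the Leibniz expansion is nonzero, which places one particle in each orbital ball.
Compact support and the Coulomb bound both follow from this. -/
theorem exists_perm_of_slater_ne_zero {r : Config N} (h : slater N r ≠ 0) :
    ∃ σ : Equiv.Perm (Fin N), ∀ i,
      dist (r (σ i)) (EuclideanSpace.single (0 : Fin 3) (3 * (i : ℝ)) : Point) < 1 := by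
  rw [slater, Complex.ofReal_ne_zero, Matrix.det_apply] at h
  obtain ⟨σ, -, hσ⟩ := Finset.exists_ne_zero_of_sum_ne_zero h
  refine ⟨σ, fun i => (orbital_ne_zero_iff i _).1 ?_⟩
  have := right_ne_zero_of_smul hσ
  exact Finset.prod_ne_zero_iff.1 this i (Finset.mem_univ i)

theorem hasCompactSupport_slater : HasCompactSupport (slater N) := by
  refine HasCompactSupport.of_support_subset_isCompact
    (isCompact_closedBall (0 : Config N) (3 * N + 1)) fun r hr => ?_
  obtain ⟨σ, hσ⟩ := exists_perm_of_slater_ne_zero hr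
  rw [mem_closedBall_zero_iff, pi_norm_le_iff_of_nonneg (by positivity)]
  intro j
  have h1 := hσ (σ.symm j)
  rw [Equiv.apply_symm_apply] at h1
  have h2 : ‖(EuclideanSpace.single (0 : Fin 3) (3 * ((σ.symm j : Fin N) : ℝ)) : Point)‖
      ≤ 3 * N := by
    rw [PiLp.norm_single, Real.norm_of_nonneg (by positivity)]
    have : ((σ.symm j : Fin N) : ℝ) ≤ N := by exact_mod_cast (σ.symm j).2.le
    linarith
  have h3 := norm_le_norm_add_norm_sub' (r j)
    (EuclideanSpace.single (0 : Fin 3) (3 * ((σ.symm j : Fin N) : ℝ)) : Point)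
  rw [dist_eq_norm] at h1
  linarith

/-- Centres at mutual distance at least `3` and radii `1` keep distinct particles at distance at
least `1`, so the singularity is never met. -/
theorem coulomb_le_of_slater_ne_zero {r : Config N} (h : slater N r ≠ 0) :
    coulomb r ≤ N * N := by
  obtain ⟨σ, hσ⟩ := exists_perm_of_slater_ne_zero h
  have hd : ∀ i j, i ≠ j → 1 ≤ dist (r i) (r j) := by
    intro i j hij
    have hi := hσ (σ.symm i)
    have hj := hσ (σ.symm j)
    rw [Equiv.apply_symm_apply] at hi hj
    have h3 := three_le_dist_centre (fun e => hij (σ.symm.injective e))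
    have h4 := dist_triangle4 (EuclideanSpace.single (0 : Fin 3) (3 * ((σ.symm i : Fin N) : ℝ)) :
      Point) (r i) (r j) (EuclideanSpace.single (0 : Fin 3) (3 * ((σ.symm j : Fin N) : ℝ)))
    rw [dist_comm _ (r i)] at h4
    linarith
  calc coulomb r ≤ ∑ _i : Fin N, ∑ _j : Fin N, (1 : ℝ) := by
        refine Finset.sum_le_sum fun i _ => Finset.sum_le_sum fun j _ => ?_
        split_ifs with hij
        · exact inv_le_one_of_one_le₀ (hd i j hij.ne)
        · exact zero_le_one
    _ = N * N := by simp

/-- Evaluation at the centres gives the identity matrix; this shows the determinant is not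
identically zero, so it can be normalized. -/
theorem slater_centres :
    slater N (fun i => EuclideanSpace.single (0 : Fin 3) (3 * (i : ℝ))) = 1 := by
  have h : (Matrix.of fun j i : Fin N =>
      orbital N i (EuclideanSpace.single (0 : Fin 3) (3 * (j : ℝ)))) = 1 := by
    ext j i
    by_cases hij : j = i
    · subst hij
      simp only [Matrix.of_apply, Matrix.one_apply_eq]
      exact (orbital N j).one_of_mem_closedBall (by simp [orbital])
    · rw [Matrix.of_apply, Matrix.one_apply_ne hij]
      by_contra h0
      have := (orbital_ne_zero_iff _ _).1 h0
      linarith [three_le_dist_centre hij]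
  rw [slater, h, Matrix.det_one, Complex.ofReal_one]

theorem exists_smul_lintegral_sq_eq_one {g : Config N → ℂ} (hg : Continuous g)
    (hc : HasCompactSupport g) {x : Config N} (hx : g x ≠ 0) :
    ∃ c : ℝ, ∫⁻ r, ‖c • g r‖ₑ ^ 2 = 1 := by
  obtain ⟨A, hA⟩ : ∃ A, A = ∫⁻ r, ‖g r‖ₑ ^ 2 := ⟨_, rfl⟩
  have hAt : A ≠ ⊤ := hA ▸ lintegral_enorm_sq_ne_top (hg.memLp_of_hasCompactSupport hc)
  have hA0 : A ≠ 0 := by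
    intro h0
    have h1 := (lintegral_eq_zero_iff (hg.measurable.enorm.pow_const 2)).1 (hA ▸ h0)
    have h2 : g =ᵐ[volume] fun _ => 0 := by
      filter_upwards [h1] with r hr
      simpa using hr
    exact hx (congrFun ((Continuous.ae_eq_iff_eq volume hg continuous_const).1 h2) x)
  have hApos : 0 < A.toReal := ENNReal.toReal_pos hA0 hAt
  have hn : ∀ r, ‖(Real.sqrt A.toReal)⁻¹ • g r‖ₑ ^ 2 = A⁻¹ * ‖g r‖ₑ ^ 2 := by
    intro r
    rw [enorm_smul, mul_pow, Real.enorm_of_nonneg (by positivity),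
      ← ENNReal.ofReal_pow (by positivity), inv_pow, Real.sq_sqrt hApos.le,
      ENNReal.ofReal_inv_of_pos hApos, ENNReal.ofReal_toReal hAt]
  refine ⟨(Real.sqrt A.toReal)⁻¹, ?_⟩
  simp only [hn]
  rw [lintegral_const_mul' _ _ (ENNReal.inv_ne_top.2 hA0), ← hA]
  exact ENNReal.inv_mul_cancel hA0 hAt

theorem lintegral_coulomb_mul_smul_slater_ne_top {c : ℝ}
    (h1 : ∫⁻ r, ‖c • slater N r‖ₑ ^ 2 = 1) :
    ∫⁻ r, ENNReal.ofReal (coulomb r) * ‖c • slater N r‖ₑ ^ 2 ≠ ⊤ := by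
  have h2 : ∫⁻ r, ENNReal.ofReal (coulomb r) * ‖c • slater N r‖ₑ ^ 2 ≤
      ∫⁻ r, ENNReal.ofReal (N * N) * ‖c • slater N r‖ₑ ^ 2 := by
    refine lintegral_mono fun r => ?_
    by_cases hr : slater N r = 0
    · simp [hr]
    · exact mul_le_mul_left (ENNReal.ofReal_le_ofReal (coulomb_le_of_slater_ne_zero hr)) _
  rw [lintegral_const_mul' _ _ ENNReal.ofReal_ne_top, h1, mul_one] at h2
  exact (h2.trans_lt ENNReal.ofReal_lt_top).ne

theorem exists_smooth_antisymmetric (N : ℕ) : ∃ h : Config N → ℂ, ContDiff ℝ 1 h ∧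
    HasCompactSupport h ∧
    (∀ (σ : Equiv.Perm (Fin N)) r, h (r ∘ σ) = ((Equiv.Perm.sign σ : ℤ) : ℂ) * h r) ∧
    ∫⁻ r, ‖h r‖ₑ ^ 2 = 1 ∧ ∫⁻ r, ENNReal.ofReal (coulomb r) * ‖h r‖ₑ ^ 2 ≠ ⊤ := by
  obtain ⟨c, h1⟩ := exists_smul_lintegral_sq_eq_one contDiff_slater.continuous
    hasCompactSupport_slater (slater_centres (N := N) |>.trans_ne one_ne_zero)
  refine ⟨fun r => c • slater N r, contDiff_slater.const_smul c,
    hasCompactSupport_slater.smul_left (f := fun _ => c), fun σ r => ?_, h1,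
    lintegral_coulomb_mul_smul_slater_ne_top h1⟩
  simp only [slater_comp_perm, mul_smul_comm]

end SlaterDeterminant

/-! ### Fully spin-polarized wave functions. -/

section Polarized

variable {N : ℕ}

/-- The wave function with spatial part `g` and all spins up. -/
def polarized (g : Config N → ℂ) : WaveFunction N :=
  fun s => if s = fun _ => 0 then g else 0

theorem sum_polarized {M : Type*} [AddCommMonoid M] (g : Config N → ℂ)
    (Φ : (Config N → ℂ) → M) (h0 : Φ 0 = 0) : ∑ s, Φ (polarized g s) = Φ g := by
  rw [Finset.sum_eq_single (fun _ => 0)]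
  · simp [polarized]
  · intro s _ hs
    simp [polarized, hs, h0]
  · simp

theorem isH1_of_contDiff {g : Config N → ℂ} (hg : ContDiff ℝ 1 g) (hc : HasCompactSupport g) :
    IsH1 g :=
  ⟨hg.continuous.memLp_of_hasCompactSupport hc, fun i a => ⟨_,
    ((hg.continuous_fderiv one_ne_zero).clm_apply continuous_const).memLp_of_hasCompactSupport
      (hc.fderiv_apply ℝ (unitVec i a)), hasWeakPartial_fderiv hg i a⟩⟩

theorem weakPartial_ae_eq_fderiv {g : Config N → ℂ} (hg : ContDiff ℝ 1 g)
    (hc : HasCompactSupport g) (i : Fin N) (a : Fin 3) :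
    weakPartial i a g =ᵐ[volume] fun r => fderiv ℝ g r (unitVec i a) :=
  weakPartial_ae_eq (((hg.continuous_fderiv one_ne_zero).clm_apply
    continuous_const).memLp_of_hasCompactSupport (hc.fderiv_apply ℝ (unitVec i a)))
    (hasWeakPartial_fderiv hg i a)

theorem lintegral_weakPartial {g : Config N → ℂ} (hg : ContDiff ℝ 1 g)
    (hc : HasCompactSupport g) (i : Fin N) (a : Fin 3) :
    ∫⁻ r, ‖weakPartial i a g r‖ₑ ^ 2 = ∫⁻ r, ‖fderiv ℝ g r (unitVec i a)‖ₑ ^ 2 := by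
  refine lintegral_congr_ae ?_
  filter_upwards [weakPartial_ae_eq_fderiv hg hc i a] with r hr
  rw [hr]

theorem polarized_mem_WN {g : Config N → ℂ} (hg : ContDiff ℝ 1 g) (hc : HasCompactSupport g)
    (ha : ∀ (σ : Equiv.Perm (Fin N)) r, g (r ∘ σ) = ((Equiv.Perm.sign σ : ℤ) : ℂ) * g r)
    (h1 : ∫⁻ r, ‖g r‖ₑ ^ 2 = 1) : polarized g ∈ WN N := by
  refine ⟨⟨fun s => ?_, fun σ s => Filter.Eventually.of_forall fun r => ?_⟩, ?_⟩
  · unfold polarized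
    split_ifs
    · exact isH1_of_contDiff hg hc
    · exact isH1_of_contDiff contDiff_const HasCompactSupport.zero
  · have hs : s ∘ σ = (fun _ => 0) ↔ s = fun _ => 0 := by
      constructor
      · intro h
        funext j
        simpa using congrFun h (σ.symm j)
      · rintro rfl
        rfl
    by_cases h : s = fun _ => 0
    · simp only [polarized, if_pos h, if_pos (hs.2 h), ha]
    · simp only [polarized, if_neg h, if_neg (mt hs.1 h), Pi.zero_apply, mul_zero]
  · rw [sum_polarized g (fun u => ∫⁻ r, ‖u r‖ₑ ^ 2) (by simp), h1]

theorem contDiff_zero_config : ContDiff ℝ 1 (0 : Config N → ℂ) := contDiff_const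

theorem internalEnergy_polarized {g : Config N → ℂ} (hg : ContDiff ℝ 1 g)
    (hc : HasCompactSupport g) :
    internalEnergy (polarized g) =
      2⁻¹ * (∑ i, ∑ a, ∫⁻ r, ‖fderiv ℝ g r (unitVec i a)‖ₑ ^ 2) +
        ∫⁻ r, ENNReal.ofReal (coulomb r) * ‖g r‖ₑ ^ 2 := by
  have h0 : ∀ (i : Fin N) (a : Fin 3),
      ∫⁻ r, ‖weakPartial i a (0 : Config N → ℂ) r‖ₑ ^ 2 = 0 := by
    intro i a
    rw [lintegral_weakPartial contDiff_zero_config HasCompactSupport.zero]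
    simp
  rw [internalEnergy, sum_polarized g (fun u => ∑ i, ∑ a, ∫⁻ r, ‖weakPartial i a u r‖ₑ ^ 2)
    (by simp [h0]), sum_polarized g (fun u => ∫⁻ r, ENNReal.ofReal (coulomb r) * ‖u r‖ₑ ^ 2)
    (by simp)]
  simp only [lintegral_weakPartial hg hc]

theorem density_polarized {n : ℕ} (g : Config (n + 1) → ℂ) (x : Point) :
    density (polarized g) x = ((n + 1 : ℕ) : ℝ≥0∞) *
      ∫⁻ y : Config n, ‖g (Fin.cons x y : Config (n + 1))‖ₑ ^ 2 := by
  rw [density, sum_polarized g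
    (fun u => ∫⁻ y : Config n, ‖u (Fin.cons x y : Config (n + 1))‖ₑ ^ 2) (by simp)]

end Polarized

/-! ### Dilations, pure states and the vanishing trial sequence. -/

section Scaling

open Filter
open scoped Topology

theorem lintegral_comp_smul_eq {G : Type*} [NormedAddCommGroup G] [NormedSpace ℝ G]
    [FiniteDimensional ℝ G] [MeasureSpace G] [BorelSpace G]
    [(volume : Measure G).IsAddHaarMeasure] {lam : ℝ} (hl : 0 < lam) (Φ : G → ℝ≥0∞) :
    ∫⁻ r, Φ (lam • r) = ENNReal.ofReal (lam ^ Module.finrank ℝ G)⁻¹ * ∫⁻ r, Φ r := by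
  have he : MeasurableEmbedding fun r : G => lam • r :=
    (Homeomorph.smulOfNeZero lam hl.ne').measurableEmbedding
  have h := he.lintegral_map (μ := (volume : Measure G)) Φ
  rw [Measure.map_addHaar_smul volume hl.ne', lintegral_smul_measure, abs_of_pos (by positivity)] at h
  rw [← h, smul_eq_mul]

theorem finrank_config (N : ℕ) : Module.finrank ℝ (Config N) = N * 3 := by
  simp [Module.finrank_pi_fintype]

variable {N : ℕ}

/-- The `L²`-normalized dilation of `h` by the factor `lam`. -/
noncomputable def dilate (lam : ℝ) (h : Config N → ℂ) (r : Config N) : ℂ :=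
  Real.sqrt (lam ^ (N * 3)) • h (lam • r)

theorem enorm_sqrt_smul_sq {lam : ℝ} (hl : 0 < lam) (m : ℕ) (z : ℂ) :
    ‖Real.sqrt (lam ^ m) • z‖ₑ ^ 2 = ENNReal.ofReal (lam ^ m) * ‖z‖ₑ ^ 2 := by
  rw [enorm_smul, mul_pow, Real.enorm_of_nonneg (Real.sqrt_nonneg _),
    ← ENNReal.ofReal_pow (Real.sqrt_nonneg _), Real.sq_sqrt (by positivity)]

theorem contDiff_dilate {h : Config N → ℂ} (hh : ContDiff ℝ 1 h) (lam : ℝ) :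
    ContDiff ℝ 1 (dilate lam h) :=
  (hh.comp (contDiff_const_smul lam)).const_smul (Real.sqrt (lam ^ (N * 3)))

theorem hasCompactSupport_dilate {h : Config N → ℂ} (hc : HasCompactSupport h) {lam : ℝ}
    (hl : 0 < lam) : HasCompactSupport (dilate lam h) :=
  (hc.comp_smul hl.ne').smul_left (f := fun _ => Real.sqrt (lam ^ (N * 3)))

theorem lintegral_dilate {lam : ℝ} (hl : 0 < lam) (Φ : Config N → ℝ≥0∞) (h : Config N → ℂ) :
    ∫⁻ r, Φ (lam • r) * ‖dilate lam h r‖ₑ ^ 2 = ∫⁻ r, Φ r * ‖h r‖ₑ ^ 2 := by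
  have e : ∀ r, Φ (lam • r) * ‖dilate lam h r‖ₑ ^ 2 =
      ENNReal.ofReal (lam ^ (N * 3)) * (Φ (lam • r) * ‖h (lam • r)‖ₑ ^ 2) := by
    intro r
    rw [dilate, enorm_sqrt_smul_sq hl]
    ring
  simp only [e]
  rw [lintegral_const_mul' _ _ ENNReal.ofReal_ne_top,
    lintegral_comp_smul_eq hl fun r => Φ r * ‖h r‖ₑ ^ 2, finrank_config, ← mul_assoc,
    ← ENNReal.ofReal_mul (by positivity), mul_inv_cancel₀ (by positivity), ENNReal.ofReal_one,
    one_mul]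

theorem lintegral_fderiv_dilate {lam : ℝ} (hl : 0 < lam) {h : Config N → ℂ}
    (hh : ContDiff ℝ 1 h) (i : Fin N) (a : Fin 3) :
    ∫⁻ r, ‖fderiv ℝ (dilate lam h) r (unitVec i a)‖ₑ ^ 2 =
      ENNReal.ofReal (lam ^ 2) * ∫⁻ r, ‖fderiv ℝ h r (unitVec i a)‖ₑ ^ 2 := by
  have e : ∀ r, fderiv ℝ (dilate lam h) r (unitVec i a) =
      lam • dilate lam (fun r => fderiv ℝ h r (unitVec i a)) r := by
    intro r
    have h1 : HasFDerivAt (fun r : Config N => h (lam • r)) _ r :=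
      ((hh.differentiable one_ne_zero) (lam • r)).hasFDerivAt.comp r
        ((hasFDerivAt_id r).const_smul lam)
    have h2 : fderiv ℝ (dilate lam h) r = _ := (h1.const_smul (Real.sqrt (lam ^ (N * 3)))).fderiv
    rw [h2]
    simp [dilate]
    ring
  have e2 : ∀ r, ‖fderiv ℝ (dilate lam h) r (unitVec i a)‖ₑ ^ 2 = ENNReal.ofReal (lam ^ 2) *
      ‖dilate lam (fun r => fderiv ℝ h r (unitVec i a)) r‖ₑ ^ 2 := by
    intro r
    rw [e, enorm_smul, mul_pow, Real.enorm_of_nonneg hl.le, ENNReal.ofReal_pow hl.le]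
  simp only [e2]
  rw [lintegral_const_mul' _ _ ENNReal.ofReal_ne_top]
  have := lintegral_dilate hl (fun _ => 1) (fun r => fderiv ℝ h r (unitVec i a))
  simp only [one_mul] at this
  rw [this]

theorem coulomb_smul {lam : ℝ} (hl : 0 < lam) (r : Config N) :
    coulomb r = lam * coulomb (lam • r) := by
  simp only [coulomb, Finset.mul_sum]
  refine Finset.sum_congr rfl fun i _ => Finset.sum_congr rfl fun j _ => ?_
  split_ifs
  · rw [Pi.smul_apply, Pi.smul_apply, dist_smul₀, Real.norm_of_nonneg hl.le, mul_inv,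
      mul_inv_cancel_left₀ hl.ne']
  · simp

/-- Each derivative contributes a factor `lam`, and the Coulomb potential is homogeneous of degree
`-1`. -/
theorem internalEnergy_dilate {lam : ℝ} (hl : 0 < lam) {h : Config N → ℂ}
    (hh : ContDiff ℝ 1 h) (hc : HasCompactSupport h) :
    internalEnergy (polarized (dilate lam h)) =
      ENNReal.ofReal (lam ^ 2) *
        (2⁻¹ * ∑ i, ∑ a, ∫⁻ r, ‖fderiv ℝ h r (unitVec i a)‖ₑ ^ 2) +
      ENNReal.ofReal lam * ∫⁻ r, ENNReal.ofReal (coulomb r) * ‖h r‖ₑ ^ 2 := by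
  rw [internalEnergy_polarized (contDiff_dilate hh lam) (hasCompactSupport_dilate hc hl)]
  congr 1
  · simp only [lintegral_fderiv_dilate hl hh, ← Finset.mul_sum]
    ring
  · rw [← lintegral_dilate hl (fun r => ENNReal.ofReal (coulomb r)) h,
      ← lintegral_const_mul' _ _ ENNReal.ofReal_ne_top]
    refine lintegral_congr fun r => ?_
    rw [coulomb_smul hl r, ENNReal.ofReal_mul hl.le, mul_assoc]

/-- Integrating out `n` particles uses up `lam ^ (n * 3)` of the normalization `lam ^ ((n + 1) *
3)`. -/
theorem density_dilate {n : ℕ} {lam : ℝ} (hl : 0 < lam) (h : Config (n + 1) → ℂ) (x : Point) :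
    density (polarized (dilate lam h)) x =
      ENNReal.ofReal (lam ^ 3) * density (polarized h) (lam • x) := by
  have e : ∀ y : Config n, lam • (Fin.cons x y : Config (n + 1)) = Fin.cons (lam • x) (lam • y) := by
    intro y
    funext i
    refine Fin.cases ?_ (fun j => ?_) i <;> simp
  simp only [density_polarized, dilate, enorm_sqrt_smul_sq hl, e]
  rw [lintegral_const_mul' _ _ ENNReal.ofReal_ne_top, lintegral_comp_smul_eq hl
    (fun y : Config n => ‖h (Fin.cons (lam • x) y : Config (n + 1))‖ₑ ^ 2), finrank_config]
  have : ENNReal.ofReal (lam ^ ((n + 1) * 3)) * ENNReal.ofReal (lam ^ (n * 3))⁻¹ =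
      ENNReal.ofReal (lam ^ 3) := by
    rw [← ENNReal.ofReal_mul (by positivity)]
    congr 1
    rw [add_mul, one_mul, pow_add]
    field_simp
  rw [← this]
  ring

theorem exists_density_polarized_le {n : ℕ} {h : Config (n + 1) → ℂ} (hh : Continuous h)
    (hc : HasCompactSupport h) : ∃ B : ℝ≥0∞, B ≠ ⊤ ∧ ∀ x, density (polarized h) x ≤ B := by
  obtain ⟨C, hC⟩ := hc.exists_bound_of_continuous hh
  set K : Set (Config n) := (fun r : Config (n + 1) => (Fin.tail r : Config n)) '' tsupport h
  have hK : IsCompact K := hc.isCompact.image (by unfold Fin.tail; fun_prop)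
  refine ⟨((n + 1 : ℕ) : ℝ≥0∞) * (ENNReal.ofReal C ^ 2 * volume K),
    ENNReal.mul_ne_top (ENNReal.natCast_ne_top _)
      (ENNReal.mul_ne_top (ENNReal.pow_ne_top ENNReal.ofReal_ne_top) hK.measure_lt_top.ne),
    fun x => ?_⟩
  rw [density_polarized]
  gcongr
  rw [← lintegral_indicator_const hK.measurableSet]
  refine lintegral_mono fun y => ?_
  by_cases hy : h (Fin.cons x y : Config (n + 1)) = 0
  · simp [hy]
  · rw [Set.indicator_of_mem (show y ∈ K from
      ⟨Fin.cons x y, subset_tsupport _ hy, Fin.tail_cons _ _⟩)]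
    gcongr
    rw [← ofReal_norm]
    exact ENNReal.ofReal_le_ofReal (hC _)

/-- The pure state of a single wave function. -/
def pureState (ψ : WaveFunction N) (hψ : ψ ∈ WN N) : DensityOperator N where
  weight := Pi.single 0 1
  state := fun _ => ψ
  tsum_weight := tsum_pi_single 0 1
  state_mem := fun _ _ => hψ
  orthogonal := fun j k hjk hj hk => by
    have h0 : ∀ m : ℕ, (Pi.single 0 1 : ℕ → ℝ≥0∞) m ≠ 0 → m = 0 := fun m hm => by
      by_contra h
      exact hm (Pi.single_eq_of_ne h 1)
    exact absurd ((h0 j hj).trans (h0 k hk).symm) hjk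

theorem tsum_pureState_weight_mul (ψ : WaveFunction N) (hψ : ψ ∈ WN N) (c : ℝ≥0∞) :
    ∑' k, (pureState ψ hψ).weight k * c = c := by
  rw [ENNReal.tsum_mul_right, (pureState ψ hψ).tsum_weight, one_mul]

/-- The norm bound is the interpolation `‖ρ‖₂² ≤ ‖ρ‖_∞ ‖ρ‖₁` with mass `n + 1`; the energy bound
comes from the pure state of `ψ`. -/
theorem exists_FDM_le {n : ℕ} {ψ : WaveFunction (n + 1)} (hψ : ψ ∈ WN (n + 1)) {B : ℝ≥0∞}
    (hB : B ≠ ⊤) (hle : ∀ x, density ψ x ≤ B) :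
    ∃ ρ : L2, FDM (n + 1) ρ ≤ (internalEnergy ψ : EReal) ∧
      ‖ρ‖ₑ ^ 2 ≤ B * ((n + 1 : ℕ) : ℝ≥0∞) := by
  have hne : ∀ x, density ψ x ≠ ⊤ := fun x => ((hle x).trans_lt hB.lt_top).ne
  have hm := aemeasurable_density fun s => (hψ.1.1 s).1.1
  have hnorm : eLpNorm (fun x => (density ψ x).toReal) 2 volume ^ 2 ≤
      B * ((n + 1 : ℕ) : ℝ≥0∞) := by
    rw [eLpNorm_eq_lintegral_rpow_enorm_toReal (by norm_num) (by norm_num), ← ENNReal.rpow_natCast,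
      ← ENNReal.rpow_mul]
    norm_num
    calc ∫⁻ x, ‖(density ψ x).toReal‖ₑ ^ 2 ≤ ∫⁻ x, B * density ψ x := by
          refine lintegral_mono fun x => ?_
          rw [Real.enorm_of_nonneg ENNReal.toReal_nonneg, ENNReal.ofReal_toReal (hne x), sq]
          exact mul_le_mul_left (hle x) _
      _ = _ := by
          rw [lintegral_const_mul' _ _ hB, lintegral_density hψ]
          push_cast
          rfl
  have hmem : MemLp (fun x => (density ψ x).toReal) 2 (volume : Measure Point) := by
    refine ⟨hm.ennreal_toReal.aestronglyMeasurable, ?_⟩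
    have h1 := hnorm.trans_lt (ENNReal.mul_lt_top hB.lt_top (ENNReal.natCast_lt_top _))
    exact (ENNReal.pow_lt_top_iff.1 h1).resolve_right two_ne_zero
  refine ⟨hmem.toLp _, ?_, ?_⟩
  · refine EReal.coe_ennreal_le_coe_ennreal_iff.2 (iInf₂_le_of_le (pureState ψ hψ) ?_ ?_)
    · filter_upwards [hmem.coeFn_toLp] with x hx
      rw [hx, EReal.coe_ennreal_toReal (hne x)]
      exact congrArg _ (tsum_pureState_weight_mul ψ hψ (density ψ x))
    · exact (tsum_pureState_weight_mul ψ hψ (internalEnergy ψ)).le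
  · rwa [Lp.enorm_toLp]

/-- Dilated trial states have energies tending to zero and densities tending strongly to zero. -/
theorem exists_tendsto_zero (n : ℕ) : ∃ (ψ : ℕ → WaveFunction (n + 1)) (ρ : ℕ → L2),
    (∀ k, ψ k ∈ WN (n + 1)) ∧ Tendsto (fun k => internalEnergy (ψ k)) atTop (𝓝 0) ∧
    Tendsto ρ atTop (𝓝 0) ∧ ∀ k, FDM (n + 1) (ρ k) ≤ (internalEnergy (ψ k) : EReal) := by
  obtain ⟨h, hh, hc, ha, h1, hW⟩ := exists_smooth_antisymmetric (n + 1)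
  obtain ⟨B, hB, hBle⟩ := exists_density_polarized_le hh.continuous hc
  set lam : ℕ → ℝ := fun k => ((k : ℝ) + 1)⁻¹
  have hl : ∀ k, 0 < lam k := fun k => by positivity
  have hlim : Tendsto lam atTop (𝓝 0) := by
    simpa [one_div] using tendsto_one_div_add_atTop_nhds_zero_nat (𝕜 := ℝ)
  have hlimp : ∀ m : ℕ, m ≠ 0 → Tendsto (fun k => ENNReal.ofReal (lam k ^ m)) atTop (𝓝 0) := by
    intro m hm
    have := ENNReal.tendsto_ofReal (hlim.pow m)
    rwa [zero_pow hm, ENNReal.ofReal_zero] at this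
  have hmem : ∀ k, polarized (dilate (lam k) h) ∈ WN (n + 1) := by
    intro k
    refine polarized_mem_WN (contDiff_dilate hh _) (hasCompactSupport_dilate hc (hl k))
      (fun σ r => ?_) ?_
    · have e : lam k • (r ∘ σ) = (lam k • r) ∘ σ := rfl
      rw [dilate, e, ha, dilate, mul_smul_comm]
    · have := lintegral_dilate (hl k) (fun _ => 1) h
      simpa only [one_mul, h1] using this
  have hD : ∀ k x, density (polarized (dilate (lam k) h)) x ≤ ENNReal.ofReal (lam k ^ 3) * B := by
    intro k x
    rw [density_dilate (hl k)]
    exact mul_le_mul_right (hBle _) _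
  choose ρ hρ hρn using fun k => exists_FDM_le (hmem k)
    (ENNReal.mul_ne_top ENNReal.ofReal_ne_top hB) (hD k)
  refine ⟨_, ρ, hmem, ?_, ?_, hρ⟩
  · simp only [fun k => internalEnergy_dilate (hl k) hh hc]
    have hT : 2⁻¹ * ∑ i, ∑ a, ∫⁻ r, ‖fderiv ℝ h r (unitVec i a)‖ₑ ^ 2 ≠ ⊤ := by
      refine ENNReal.mul_ne_top (by simp) (ENNReal.sum_ne_top.2 fun i _ =>
        ENNReal.sum_ne_top.2 fun a _ => lintegral_enorm_sq_ne_top ?_)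
      exact ((hh.continuous_fderiv one_ne_zero).clm_apply
        continuous_const).memLp_of_hasCompactSupport (hc.fderiv_apply ℝ (unitVec i a))
    have hA := ENNReal.Tendsto.mul_const (hlimp 2 two_ne_zero) (Or.inr hT)
    have hC := ENNReal.Tendsto.mul_const (hlimp 1 one_ne_zero) (Or.inr hW)
    simpa using hA.add hC
  · rw [tendsto_zero_iff_norm_tendsto_zero]
    have h3 : Tendsto (fun k => ENNReal.ofReal (lam k ^ 3) * B * ((n + 1 : ℕ) : ℝ≥0∞)) atTop
        (𝓝 0) := by
      have := ENNReal.Tendsto.mul_const (ENNReal.Tendsto.mul_const (hlimp 3 three_ne_zero)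
        (Or.inr hB)) (b := ((n + 1 : ℕ) : ℝ≥0∞)) (Or.inr (ENNReal.natCast_ne_top _))
      simpa using this
    have h4 := tendsto_of_tendsto_of_tendsto_of_le_of_le tendsto_const_nhds h3
      (fun k => zero_le) hρn
    have h5 := ((ENNReal.continuous_rpow_const (y := 1 / 2)).tendsto 0).comp h4
    have h6 := (ENNReal.tendsto_toReal (by simp)).comp h5
    have e : ∀ x : ℝ≥0∞, (x ^ 2) ^ (2⁻¹ : ℝ) = x := fun x => by
      rw [← ENNReal.rpow_natCast, ← ENNReal.rpow_mul]; norm_num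
    simpa [Function.comp_def, e, ENNReal.zero_rpow_of_pos] using h6

end Scaling

/-! ### Values of `E` and `F`, and absence of ground states. -/

section MainTheorem

open Filter
open scoped Topology

variable {n : ℕ}

/-- Strong convergence of the trial densities to `0` makes `⟨v, ρ_k⟩` vanish in the limit for every
`v`, whatever its sign. -/
theorem E_nonpos (v : L2) : E (n + 1) v ≤ 0 := by
  obtain ⟨ψ, ρ, -, hT, hρ, hF⟩ := exists_tendsto_zero n
  have h1 : Tendsto (fun k => (internalEnergy (ψ k) : EReal)) atTop (𝓝 0) :=
    (continuous_coe_ennreal_ereal.tendsto 0).comp hT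
  have h2 : Tendsto (fun k => ((inner ℝ v (ρ k) : ℝ) : EReal)) atTop (𝓝 0) := by
    have : Tendsto (fun k => inner ℝ v (ρ k)) atTop (𝓝 (inner ℝ v (0 : L2))) :=
      tendsto_const_nhds.inner hρ
    rw [inner_zero_right] at this
    exact (continuous_coe_real_ereal.tendsto 0).comp this
  have h3 : Tendsto (fun k => (internalEnergy (ψ k) : EReal) + ((inner ℝ v (ρ k) : ℝ) : EReal))
      atTop (𝓝 (0 + 0)) :=
    (EReal.continuousAt_add (by simp) (by simp)).tendsto.comp (h1.prodMk_nhds h2)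
  rw [add_zero] at h3
  exact ge_of_tendsto' h3 fun k => (iInf_le _ (ρ k)).trans (by gcongr; exact hF k)

theorem E_eq_zero {v : L2} (hv : ∀ᵐ r : Point, 0 ≤ v r) : E (n + 1) v = 0 :=
  le_antisymm (E_nonpos v) (E_nonneg hv)

theorem E_zero : E (n + 1) 0 = 0 := by
  refine E_eq_zero ?_
  filter_upwards [Lp.coeFn_zero ℝ 2 (volume : Measure Point)] with r hr
  rw [hr]
  exact le_rfl

theorem F_nonneg (ρ : L2) : 0 ≤ F (n + 1) ρ := by
  refine le_iSup_of_le (0 : L2) ?_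
  rw [E_zero]
  simp

theorem F_zero : F (n + 1) 0 = 0 := by
  refine le_antisymm (iSup_le fun v => ?_) (F_nonneg 0)
  simpa using E_nonpos v

/-- Along the trial densities `FDM` drops below `1`, although it is `⊤` at their limit. -/
theorem not_lowerSemicontinuous_FDM : ¬ LowerSemicontinuous (FDM (n + 1)) := by
  intro h
  obtain ⟨ψ, ρ, -, hT, hρ, hF⟩ := exists_tendsto_zero n
  have h1 : ∀ᶠ k in atTop, (1 : EReal) < FDM (n + 1) (ρ k) :=
    hρ.eventually (h 0 1 (by
      change (1 : EReal) < FDM (n + 1) 0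
      rw [FDM_zero]
      exact EReal.coe_lt_top 1))
  have h2 : ∀ᶠ k in atTop, internalEnergy (ψ k) < 1 := hT.eventually_lt_const one_pos
  obtain ⟨k, hk1, hk2⟩ := (h1.and h2).exists
  have h3 := hk1.trans_le (hF k)
  rw [← EReal.coe_ennreal_one, EReal.coe_ennreal_lt_coe_ennreal_iff] at h3
  exact lt_asymm h3 hk2

theorem energy_zero {N : ℕ} (ψ : WaveFunction N) : energy 0 ψ = (internalEnergy ψ : EReal) := by
  have h : ∫ r : Point, (density ψ r).toReal * (0 : L2) r = 0 := by
    rw [← integral_zero Point ℝ]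
    refine integral_congr_ae ?_
    filter_upwards [Lp.coeFn_zero ℝ 2 (volume : Measure Point)] with r hr
    rw [hr]
    simp
  rw [energy, h, EReal.coe_zero, add_zero]

theorem iInf_energy_zero : ⨅ φ ∈ WN (n + 1), energy 0 φ = 0 := by
  refine le_antisymm ?_ (le_iInf₂ fun φ _ => by rw [energy_zero]; exact EReal.coe_ennreal_nonneg _)
  obtain ⟨ψ, ρ, hψ, hT, -, -⟩ := exists_tendsto_zero n
  have h1 : Tendsto (fun k => (internalEnergy (ψ k) : EReal)) atTop (𝓝 0) :=
    (continuous_coe_ennreal_ereal.tendsto 0).comp hT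
  exact ge_of_tendsto' h1 fun k => (iInf₂_le (ψ k) (hψ k)).trans_eq (energy_zero _)

/-- No normalized wave function has vanishing kinetic energy. -/
theorem kinetic_ne_zero {ψ : WaveFunction (n + 1)} (hψ : ψ ∈ WN (n + 1)) :
    ¬ ∀ s i a, ∫⁻ r, ‖weakPartial i a (ψ s) r‖ₑ ^ 2 = 0 := by
  intro h
  have h0 : ∀ s, ∫⁻ r, ‖ψ s r‖ₑ ^ 2 = 0 := by
    intro s
    have := ae_eq_zero_of_hasWeakPartial_zero (hψ.1.1 s).1
      (fun a => memLp_weakPartial 0 a (ψ s)) (fun a => (hψ.1.1 s).hasWeakPartial 0 a) (h s 0)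
    rw [lintegral_congr_ae (g := fun _ => 0) (this.mono fun r hr => by simp [hr]), lintegral_zero]
  have h1 := hψ.2
  simp [h0] at h1

theorem internalEnergy_ne_zero {ψ : WaveFunction (n + 1)} (hψ : ψ ∈ WN (n + 1)) :
    internalEnergy ψ ≠ 0 := by
  intro h
  refine kinetic_ne_zero hψ fun s i a => ?_
  rw [internalEnergy, add_eq_zero, mul_eq_zero] at h
  have h1 := h.1.resolve_left (by simp)
  simp only [Finset.sum_eq_zero_iff, Finset.mem_univ, true_implies] at h1
  exact h1 s i a

theorem not_isVariationalGroundState_zero (ψ : WaveFunction (n + 1)) :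
    ¬ IsVariationalGroundState 0 ψ := by
  rintro ⟨hψ, hmin⟩
  have h : energy 0 ψ ≤ 0 := (le_iInf₂ hmin).trans_eq iInf_energy_zero
  rw [energy_zero, ← EReal.coe_ennreal_zero, EReal.coe_ennreal_le_coe_ennreal_iff] at h
  exact internalEnergy_ne_zero hψ (nonpos_iff_eq_zero.1 h)

/-- The zero class of `L2` vanishes only almost everywhere; the null set has to be pulled back along
a coordinate. -/
theorem ae_zero_apply {N : ℕ} (i : Fin N) : ∀ᵐ r : Config N, (0 : L2) (r i) = 0 :=
  (Measure.quasiMeasurePreserving_eval (fun _ : Fin N => (volume : Measure Point)) i).ae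
    (Lp.coeFn_zero ℝ 2 (volume : Measure Point))

theorem hamiltonianForm_zero_self {N : ℕ} (ψ : WaveFunction N) :
    hamiltonianForm 0 ψ ψ =
      ((2⁻¹ * (∑ s, ∑ i, ∑ a, ∫ r, ‖weakPartial i a (ψ s) r‖ ^ 2) +
        ∑ s, ∫ r : Config N, coulomb r * ‖ψ s r‖ ^ 2 : ℝ) : ℂ) := by
  have hsq : ∀ z : ℂ, (starRingEnd ℂ) z * z = ((‖z‖ ^ 2 : ℝ) : ℂ) := fun z => by
    rw [Complex.conj_mul', Complex.ofReal_pow]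
  have h2 : ∀ s, ∫ r : Config N, ((coulomb r + ∑ i, (0 : L2) (r i) : ℝ) : ℂ) *
      ((starRingEnd ℂ) (ψ s r) * ψ s r) = ((∫ r : Config N, coulomb r * ‖ψ s r‖ ^ 2 : ℝ) : ℂ) := by
    intro s
    rw [← integral_complex_ofReal]
    refine integral_congr_ae ?_
    filter_upwards [ae_all_iff.2 fun i : Fin N => ae_zero_apply i] with r hr
    rw [hsq, Finset.sum_eq_zero fun i _ => hr i, add_zero, Complex.ofReal_mul]
  rw [hamiltonianForm]
  simp only [h2]
  simp only [hsq, integral_complex_ofReal]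
  push_cast
  ring

theorem coulomb_nonneg {N : ℕ} (r : Config N) : 0 ≤ coulomb r :=
  Finset.sum_nonneg fun _ _ => Finset.sum_nonneg fun _ _ => by
    split_ifs
    · exact inv_nonneg.2 dist_nonneg
    · exact le_rfl

/-- Test the eigenvalue equation, with eigenvalue `0`, against `ψ` itself. Both parts of the form
are nonnegative, so the kinetic part vanishes; integrability of the Coulomb term is never needed. -/
theorem not_isGroundState_zero (ψ : WaveFunction (n + 1)) : ¬ IsGroundState 0 ψ := by
  rintro ⟨hψ, lam, ⟨hψ1, -, hmap⟩, hlam⟩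
  rw [iInf_energy_zero, EReal.coe_eq_zero] at hlam
  have h := hmap ψ hψ1
  rw [hamiltonianForm_zero_self, hlam] at h
  have hb : braket ψ (fun s r => ((0 : ℝ) : ℂ) * ψ s r) = 0 := by simp [braket]
  rw [hb, Complex.ofReal_eq_zero] at h
  have hk0 : ∀ s i a, 0 ≤ ∫ r, ‖weakPartial i a (ψ s) r‖ ^ 2 :=
    fun s i a => integral_nonneg fun r => by positivity
  have hc0 : 0 ≤ ∑ s, ∫ r : Config (n + 1), coulomb r * ‖ψ s r‖ ^ 2 :=
    Finset.sum_nonneg fun s _ => integral_nonneg fun r =>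
      mul_nonneg (coulomb_nonneg r) (by positivity)
  have hs0 : 0 ≤ ∑ s, ∑ i, ∑ a, ∫ r, ‖weakPartial i a (ψ s) r‖ ^ 2 :=
    Finset.sum_nonneg fun s _ => Finset.sum_nonneg fun i _ => Finset.sum_nonneg fun a _ => hk0 s i a
  have hs : ∑ s, ∑ i, ∑ a, ∫ r, ‖weakPartial i a (ψ s) r‖ ^ 2 = 0 := by linarith
  refine kinetic_ne_zero hψ fun s i a => ?_
  have h1 := (Finset.sum_eq_zero_iff_of_nonneg fun s _ => Finset.sum_nonneg fun i _ =>
    Finset.sum_nonneg fun a _ => hk0 s i a).1 hs s (Finset.mem_univ s)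
  have h2 := (Finset.sum_eq_zero_iff_of_nonneg fun i _ =>
    Finset.sum_nonneg fun a _ => hk0 s i a).1 h1 i (Finset.mem_univ i)
  have h3 := (Finset.sum_eq_zero_iff_of_nonneg fun a _ => hk0 s i a).1 h2 a (Finset.mem_univ a)
  have hm := memLp_weakPartial i a (ψ s)
  have hint : Integrable (fun r => ‖weakPartial i a (ψ s) r‖ ^ 2) volume := by
    simpa using hm.integrable_norm_pow two_ne_zero
  have h4 := (integral_eq_zero_iff_of_nonneg (fun r => by positivity) hint).1 h3
  rw [lintegral_congr_ae (g := fun _ => 0) (h4.mono fun r hr => by simpa using hr), lintegral_zero]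

end MainTheorem

end DFT

theorem mainTheorem12 (N : ℕ) (hN : 1 ≤ N) :
    -- `E` is real-valued and nonpositive, and vanishes at nonnegative potentials
    ((∀ v : DFT.L2, DFT.E N v ≠ ⊥ ∧ DFT.E N v ≤ 0) ∧
      (∀ v : DFT.L2, (∀ᵐ r : DFT.Point, 0 ≤ v r) → DFT.E N v = 0)) ∧
    -- `F[0] = 0` and `F_DM[0] = +∞`, and `F_DM` is not lower semicontinuous
    (DFT.F N 0 = 0 ∧ DFT.FDM N 0 = ⊤ ∧ ¬ LowerSemicontinuous (DFT.FDM N)) ∧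
    -- `0` is a subgradient of `F` and a supergradient of `E`, but there is no ground state
    ((0 : DFT.L2) ∈ DFT.subdifferential (DFT.F N) 0 ∧
      (0 : DFT.L2) ∈ DFT.superdifferential (DFT.E N) 0 ∧
      (¬ ∃ ψ : DFT.WaveFunction N, DFT.IsVariationalGroundState 0 ψ) ∧
      (¬ ∃ ψ : DFT.WaveFunction N, DFT.IsGroundState 0 ψ)) := by
  -- The successor form provides a first particle and selects the nontrivial branch of `density`.
  obtain ⟨n, rfl⟩ : ∃ n, N = n + 1 := ⟨N - 1, by omega⟩
  refine ⟨⟨fun v => ⟨DFT.E_ne_bot v, DFT.E_nonpos v⟩, fun v hv => DFT.E_eq_zero hv⟩,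
    ⟨DFT.F_zero, DFT.FDM_zero, DFT.not_lowerSemicontinuous_FDM⟩, fun ρ => ?_, fun v => ?_,
    fun ⟨ψ, hψ⟩ => DFT.not_isVariationalGroundState_zero ψ hψ,
    fun ⟨ψ, hψ⟩ => DFT.not_isGroundState_zero ψ hψ⟩
  · rw [DFT.F_zero, inner_zero_left, EReal.coe_zero, add_zero]
    exact DFT.F_nonneg ρ
  · rw [DFT.E_zero, inner_zero_left, EReal.coe_zero, add_zero]
    exact DFT.E_nonpos v
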